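/- Let $\mathbb M$ be the Euclidean plane, the hyperbolic plane (curvature $-1$) or the unit sphere. Consider a circle of radius $r_0>0$ in $\mathbb M$ (with $r_0<\pi$ on the sphere), of length $L=2\pi h$, where $h=r_0$, $\sinh r_0$, $\sin r_0$ respectively. The circular billiard map is $F(s,\theta)=(s+\gamma(\theta)h \bmod L,\ \theta)$ on $[0,L)\times[0,\pi]$, where $s$ is arc length, $\theta$ is the angle between the tangent of the circle and the outgoing geodesic, and $\gamma(\theta)$ is the central angle of the arc cut off by this geodesic, so that $\cot(\gamma/2)=c\cot\theta$ with $c=1$, $\cosh r_0$, $\cos r_0$ respectively. Let $0<\alpha<\pi/6$. The Feres random map $T$ on $[0,\pi]$ equals $T_i$ with probability $p_i(\theta)$, $i=1,\dots,4$, where $T_1\theta=\theta+2\alpha$, $T_2\theta=-\theta+2\pi-4\alpha$, $T_3\theta=\theta-2\alpha$, $T_4\theta=-\theta+4\alpha$, and, with $u_a(\theta)=\frac12\bigl(1+\frac{\tan a}{\tan\theta}\bigr)$, - $p_1=1$ on $[0,\alpha)$, $u_\alpha(\theta)$ on $[\alpha,\pi-3\alpha)$, $2\cos(2\alpha)u_{2\alpha}(\theta)$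 on $[\pi-3\alpha,\pi-2\alpha)$, $0$ on $[\pi-2\alpha,\pi]$; - $p_2=0$ on $[0,\pi-3\alpha)$, $u_\alpha(\theta)-2\cos(2\alpha)u_{2\alpha}(\theta)$ on $[\pi-3\alpha,\pi-2\alpha)$, $u_\alpha(\theta)$ on $[\pi-2\alpha,\pi-\alpha)$, $0$ on $[\pi-\alpha,\pi]$; - $p_3=0$ on $[0,2\alpha)$, $2\cos(2\alpha)u_{2\alpha}(-\theta)$ on $[2\alpha,3\alpha)$, $u_\alpha(-\theta)$ on $[3\alpha,\pi-\alpha)$, $1$ on $[\pi-\alpha,\pi]$; - $p_4=0$ on $[0,\alpha)$, $u_\alpha(-\theta)$ on $[\alpha,2\alpha)$, $u_\alpha(-\theta)-2\cos(2\alpha)u_{2\alpha}(-\theta)$ on $[2\alpha,3\alpha)$, $0$ on $[3\alpha,\pi]$. The random circular billiard map $\overline F$ equals $\overline F_i(s,\theta)=F(s,T_i\theta)$ with probability $p_i(\theta)$. A random map that equals $R_i$ with probability $q_i$ has the transition kernel $K(x,E)=\sum_i q_i(x)1_E(R_i x)$, and an initial distribution $\nu$ evolves under it by $\nu^{(0)}=\nu$,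 $\nu^{(n+1)}(E)=\int K(x,E)\,d\nu^{(n)}(x)$. Let $\lambda$ be the normalized Lebesgue measure on $[0,L)$ and $\mu(B)=\frac12\int_B\sin\theta\,d\theta$ on $[0,\pi]$. Suppose that $\alpha/\pi$ is irrational, and let $\nu=\lambda\times\nu_2$, where $\nu_2=g\mu$ with $g\ge 0$ and $\int g\,d\mu=1$. Then $\nu^{(n)}=\lambda\times\nu_2^{(n)}$ for every $n\ge 0$, where $\nu^{(n)}$ is the evolution of $\nu$ under $\overline F$ and $\nu_2^{(n)}$ is the evolution of $\nu_2$ under $T$; and for all Borel sets $A\subseteq[0,L)$, $B\subseteq[0,\pi]$, $$\nu^{(n)}(A\times B)\longrightarrow(\lambda\times\mu)(A\times B)\qquad(n\to\infty).$$ -/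

import Mathlib

open MeasureTheory ProbabilityTheory Filter Topology
open scoped ENNReal

namespace CircularBilliard

/-! ### Random maps and the evolution of an initial distribution -/

/-- The transition probability kernel `K(x, A) = ∑ i, p i x * 1_A (T i x)` of the random map
which equals `T i` with probability `p i`. -/
noncomputable def randomKernel {X : Type*} [MeasurableSpace X] {N : ℕ}
    (T : Fin N → X → X) (p : Fin N → X → ℝ)
    (hT : ∀ i, Measurable (T i)) (hp : ∀ i, Measurable (p i)) : Kernel X X where
  toFun x := ∑ i, ENNReal.ofReal (p i x) • Measure.dirac (T i x)
  measurable' := by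
    refine Measure.measurable_of_measurable_coe _ fun A hA => ?_
    simp only [Measure.coe_finsetSum, Finset.sum_apply, Measure.smul_apply, smul_eq_mul,
      Measure.dirac_apply' _ hA]
    refine Finset.measurable_fun_sum _ fun i _ => ?_
    exact ((hp i).ennreal_ofReal).mul ((measurable_one.indicator hA).comp (hT i))

/-- The evolution `ν^(0) = ν`, `ν^(n+1)(A) = ∫ K(x, A) dν^(n)(x)` of an initial distribution. -/
noncomputable def evolve {X : Type*} [MeasurableSpace X] (K : Kernel X X) (ν : Measure X) :
    ℕ → Measure X
  | 0 => ν
  | n + 1 => (evolve K ν n).bind K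

theorem evolve_succ_apply {X : Type*} [MeasurableSpace X] (K : Kernel X X) (ν : Measure X)
    (n : ℕ) {A : Set X} (hA : MeasurableSet A) :
    evolve K ν (n + 1) A = ∫⁻ x, K x A ∂(evolve K ν n) :=
  Measure.bind_apply hA K.measurable.aemeasurable

/-! ### The Feres random map on `[0, π]`

The maps and the probabilities are given by their formulas on the whole real line. For
`θ ∈ [0, π]` and `0 < α < π / 6`, `T_i θ` is in `[0, π]` whenever `p_i θ ≠ 0`, so a distribution
carried by `[0, π]` stays on `[0, π]`. -/

/-- The four branches `T₁, T₂, T₃, T₄` (indexed from `0`). -/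
noncomputable def feresMap (α : ℝ) : Fin 4 → ℝ → ℝ :=
  ![fun θ => θ + 2 * α,
    fun θ => -θ + 2 * Real.pi - 4 * α,
    fun θ => θ - 2 * α,
    fun θ => -θ + 4 * α]

/-- `u_a(θ) = (1 + tan a / tan θ) / 2`. At `θ = π / 2` the quotient is `0`, as it should be. -/
noncomputable def u (a θ : ℝ) : ℝ := (1 + Real.tan a / Real.tan θ) / 2

/-- The probabilities `p₁, p₂, p₃, p₄` (indexed from `0`) of the four branches. -/
noncomputable def feresProb (α : ℝ) : Fin 4 → ℝ → ℝ :=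
  ![fun θ =>
      if θ < α then 1
      else if θ < Real.pi - 3 * α then u α θ
      else if θ < Real.pi - 2 * α then 2 * Real.cos (2 * α) * u (2 * α) θ
      else 0,
    fun θ =>
      if θ < Real.pi - 3 * α then 0
      else if θ < Real.pi - 2 * α then u α θ - 2 * Real.cos (2 * α) * u (2 * α) θ
      else if θ < Real.pi - α then u α θ
      else 0,
    fun θ =>
      if θ < 2 * α then 0
      else if θ < 3 * α then 2 * Real.cos (2 * α) * u (2 * α) (-θ)
      else if θ < Real.pi - α then u α (-θ)
      else 1,
    fun θ =>
      if θ < α then 0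
      else if θ < 2 * α then u α (-θ)
      else if θ < 3 * α then u α (-θ) - 2 * Real.cos (2 * α) * u (2 * α) (-θ)
      else 0]

theorem measurable_feresMap (α : ℝ) (i : Fin 4) : Measurable (feresMap α i) := by
  fin_cases i <;> simp [feresMap] <;> fun_prop

theorem measurable_u (a : ℝ) : Measurable (u a) := by
  have h : Measurable Real.tan := by
    have : Real.tan = fun x => Real.sin x / Real.cos x := by
      ext x; exact Real.tan_eq_sin_div_cos x
    rw [this]; fun_prop
  unfold u
  fun_prop

theorem measurable_feresProb (α : ℝ) (i : Fin 4) : Measurable (feresProb α i) := by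
  have h (a b : ℝ) : MeasurableSet {θ : ℝ | a < b} := measurableSet_lt measurable_const
    measurable_const
  have h1 := measurable_u α
  have h2 := measurable_u (2 * α)
  have h3 : Measurable fun θ : ℝ => u α (-θ) := h1.comp measurable_neg
  have h4 : Measurable fun θ : ℝ => u (2 * α) (-θ) := h2.comp measurable_neg
  have lt (b : ℝ) : MeasurableSet {θ : ℝ | θ < b} := measurableSet_lt measurable_id
    measurable_const
  fin_cases i <;> simp only [feresProb] <;>
    refine Measurable.ite (lt _) (by fun_prop) (Measurable.ite (lt _) (by fun_prop)
      (Measurable.ite (lt _) (by fun_prop) (by fun_prop)))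

/-- The transition probability kernel of the Feres random map with parameter `α`. -/
noncomputable def feresKernel (α : ℝ) : Kernel ℝ ℝ :=
  randomKernel (feresMap α) (feresProb α) (measurable_feresMap α) (measurable_feresProb α)

/-! ### Circular billiards in the three planes of constant curvature -/

/-- The Euclidean plane `ℝ²`, the hyperbolic plane `ℍ²` (curvature `-1`) and the unit sphere
`𝕊²`. -/
inductive Plane
  | euclidean
  | hyperbolic
  | spherical

namespace Plane

/-- `h`, the number such that a circle of radius `r` has length `2 π h`. -/
noncomputable def h : Plane → ℝ → ℝ
  | euclidean, r => r
  | hyperbolic, r => Real.sinh r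
  | spherical, r => Real.sin r

/-- The derivative of `h` with respect to the radius. -/
noncomputable def h' : Plane → ℝ → ℝ
  | euclidean, _ => 1
  | hyperbolic, r => Real.cosh r
  | spherical, r => Real.cos r

/-- The curvature. -/
def curvature : Plane → ℝ
  | euclidean => 0
  | hyperbolic => -1
  | spherical => 1

/-- `r` is the radius of a circle: `0 < r`, and `r < π` on the unit sphere. -/
def IsRadius : Plane → ℝ → Prop
  | euclidean, r => 0 < r
  | hyperbolic, r => 0 < r
  | spherical, r => 0 < r ∧ r < Real.pi

/-- The length of the circle of radius `r`. -/
noncomputable def length (P : Plane) (r : ℝ) : ℝ := 2 * Real.pi * P.h r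

/-- The central angle `γ(θ) ∈ (0, 2π)` of the arc of the circle of radius `r` that is cut off by
the geodesic which leaves the circle at the angle `θ ∈ (0, π)` with the tangent: it is given by
`cot (γ / 2) = h'(r) cot θ` (in the Euclidean plane `γ = 2 θ`). See `centralAngle_spec`. -/
noncomputable def centralAngle (P : Plane) (r θ : ℝ) : ℝ :=
  2 * Complex.arg ⟨P.h' r * Real.cos θ, Real.sin θ⟩

/-- The length `l` of an arc of the circle of radius `r` with central angle `γ`. -/
noncomputable def arcLength (P : Plane) (r γ : ℝ) : ℝ := γ * P.h r

/-- The point with central angle `φ` of the circle of radius `r`, in the standard model of the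
plane in `ℝ³`: the plane `z = 1`, the hyperboloid `z² = 1 + x² + y²`, `z > 0`, or the unit
sphere. The centre of the circle is `(0, 0, 1)`. -/
noncomputable def circlePoint (P : Plane) (r φ : ℝ) : Fin 3 → ℝ :=
  ![P.h r * Real.cos φ, P.h r * Real.sin φ, P.h' r]

/-- The unit vector at `circlePoint P r φ` that has the angle `θ` with the tangent of the circle,
measured towards the centre. -/
noncomputable def direction (P : Plane) (r φ θ : ℝ) : Fin 3 → ℝ :=
  Real.cos θ • ![-Real.sin φ, Real.cos φ, 0] +
    Real.sin θ • ![-(P.h' r * Real.cos φ), -(P.h' r * Real.sin φ), P.curvature * P.h r]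

/-- The position at time `t` on the unit speed geodesic which starts at the point `x` with
velocity `v`. -/
noncomputable def geodesic (P : Plane) (x v : Fin 3 → ℝ) (t : ℝ) : Fin 3 → ℝ :=
  P.h' t • x + P.h t • v

/-- The geodesic that leaves the circle at the angle `θ ∈ (0, π)` meets the circle again after
the central angle `γ(θ)`. -/
theorem centralAngle_spec (P : Plane) {r θ : ℝ} (hr : P.IsRadius r) (φ : ℝ)
    (hθ : θ ∈ Set.Ioo 0 Real.pi) :
    P.centralAngle r θ ∈ Set.Ioo 0 (2 * Real.pi) ∧
      ∃ t, P.IsRadius (t / 2) ∧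
        P.geodesic (P.circlePoint r φ) (P.direction r φ θ) t =
          P.circlePoint r (φ + P.centralAngle r θ) := by
  have hS : 0 < Real.sin θ := Real.sin_pos_of_mem_Ioo hθ
  have hSC : Real.sin θ ^ 2 + Real.cos θ ^ 2 = 1 := Real.sin_sq_add_cos_sq θ
  have hid : P.curvature * P.h r ^ 2 + P.h' r ^ 2 = 1 := by
    cases P
    · simp [curvature, h']
    · simp only [curvature, h, h']; linarith [Real.cosh_sq r]
    · simp only [curvature, h, h']; linarith [Real.sin_sq_add_cos_sq r]
  set z : ℂ := ⟨P.h' r * Real.cos θ, Real.sin θ⟩ with hz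
  set a := Complex.arg z with ha
  have hγ : P.centralAngle r θ = 2 * a := rfl
  have hz0 : z ≠ 0 := fun h0 => hS.ne' (by simpa [hz] using congrArg Complex.im h0)
  set D := ‖z‖ with hDdef
  have hD : 0 < D := norm_pos_iff.mpr hz0
  have hDsq : D ^ 2 = (P.h' r * Real.cos θ) ^ 2 + Real.sin θ ^ 2 := by
    rw [hDdef, Complex.sq_norm, Complex.normSq_apply]; simp [hz]; ring
  have hcos : D * Real.cos a = P.h' r * Real.cos θ := Complex.norm_mul_cos_arg z
  have hsin : D * Real.sin a = Real.sin θ := Complex.norm_mul_sin_arg z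
  have hsa : 0 < Real.sin a := pos_of_mul_pos_right (hsin ▸ hS) hD.le
  have ha0 : 0 < a := by
    have h1 : 0 ≤ a := Complex.arg_nonneg_iff.mpr hS.le
    rcases h1.lt_or_eq with h2 | h2
    · exact h2
    · rw [← h2] at hsa; simp at hsa
  have haπ : a < Real.pi := by
    rcases (Complex.arg_le_pi z).lt_or_eq with h2 | h2
    · exact h2
    · rw [ha, h2] at hsa; simp at hsa
  refine ⟨by rw [hγ]; constructor <;> linarith, ?_⟩
  obtain ⟨t, ht, h1, h2⟩ : ∃ t, P.IsRadius (t / 2) ∧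
      D ^ 2 * P.h t = 2 * P.h r * P.h' r * Real.sin θ ∧
      P.h' t = 1 - 2 * P.curvature * P.h r ^ 2 * Real.sin a ^ 2 := by
    cases P
    · refine ⟨2 * r * Real.sin θ, ?_, ?_, ?_⟩
      · have : 0 < r := hr
        simp only [IsRadius]; positivity
      · simp only [h'] at hDsq
        rw [hDsq]; simp only [h, h']; linear_combination (2 * r * Real.sin θ) * hSC
      · simp [h', curvature]
    · simp only [h, h', curvature] at hDsq hid ⊢
      have hr0 : 0 < r := hr
      set τ := Real.arsinh (Real.sinh r * Real.sin a) with hτ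
      have hsτ : Real.sinh τ = Real.sinh r * Real.sin a := Real.sinh_arsinh _
      have hcτ : D * Real.cosh τ = Real.cosh r := by
        have h3 := Real.cosh_pos τ
        have h4 := Real.cosh_pos r
        rw [← sq_eq_sq₀ (by positivity) h4.le, mul_pow, Real.cosh_sq τ, hsτ]
        have : D ^ 2 * ((Real.sinh r * Real.sin a) ^ 2 + 1) =
            Real.sinh r ^ 2 * (D * Real.sin a) ^ 2 + D ^ 2 := by ring
        rw [this, hsin, hDsq]
        linear_combination (-Real.sin θ ^ 2) * hid + Real.cosh r ^ 2 * hSC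
      refine ⟨2 * τ, ?_, ?_, ?_⟩
      · have : 0 < τ := by
          rw [hτ, Real.arsinh_pos_iff]
          exact mul_pos (Real.sinh_pos_iff.mpr hr0) hsa
        simp only [IsRadius]; linarith
      · rw [Real.sinh_two_mul, hsτ]
        linear_combination (2 * Real.sinh r * D * Real.sin a) * hcτ
          + (2 * Real.sinh r * Real.cosh r) * hsin
      · rw [Real.cosh_two_mul, Real.cosh_sq, hsτ]; ring
    · simp only [h, h', curvature] at hDsq hid ⊢
      obtain ⟨hr0, hr1⟩ := hr
      have hs : 0 < Real.sin r := Real.sin_pos_of_pos_of_lt_pi hr0 hr1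
      set w : ℂ := ⟨Real.cos r, Real.sin r * Real.sin θ⟩ with hw
      have hwD : ‖w‖ = D := by
        rw [← sq_eq_sq₀ (norm_nonneg _) hD.le, hDsq, Complex.sq_norm, Complex.normSq_apply]
        simp only [hw]
        linear_combination (Real.sin θ ^ 2) * hid - Real.cos r ^ 2 * hSC
      set τ := Complex.arg w with hτ
      have hsτ : D * Real.sin τ = Real.sin r * Real.sin θ := by
        rw [← hwD]; exact Complex.norm_mul_sin_arg w
      have hcτ : D * Real.cos τ = Real.cos r := by
        rw [← hwD]; exact Complex.norm_mul_cos_arg w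
      have hsτ0 : 0 < Real.sin τ := pos_of_mul_pos_right (hsτ ▸ mul_pos hs hS) hD.le
      have hτ0 : 0 < τ := by
        have h1 : 0 ≤ τ := Complex.arg_nonneg_iff.mpr (mul_pos hs hS).le
        rcases h1.lt_or_eq with h2 | h2
        · exact h2
        · rw [← h2] at hsτ0; simp at hsτ0
      have hτπ : τ < Real.pi := by
        rcases (Complex.arg_le_pi w).lt_or_eq with h2 | h2
        · exact h2
        · rw [hτ, h2] at hsτ0; simp at hsτ0
      have hsτ' : Real.sin τ = Real.sin r * Real.sin a := by
        apply mul_left_cancel₀ hD.ne'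
        rw [hsτ, ← hsin]; ring
      refine ⟨2 * τ, ?_, ?_, ?_⟩
      · simp only [IsRadius]; constructor <;> linarith
      · rw [Real.sin_two_mul]
        linear_combination (2 * D * Real.cos τ) * hsτ
          + (2 * Real.sin r * Real.sin θ) * hcτ
      · rw [Real.cos_two_mul, Real.cos_sq', hsτ']; ring
  have hD2 : D ^ 2 ≠ 0 := by positivity
  have e1 : Real.cos θ * P.h t = P.h r * Real.sin (2 * a) := by
    apply mul_left_cancel₀ hD2
    rw [Real.sin_two_mul]
    linear_combination Real.cos θ * h1 - 2 * P.h r * D * Real.cos a * hsin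
      - 2 * P.h r * Real.sin θ * hcos
  have e2 : P.h r * P.h' t - P.h' r * Real.sin θ * P.h t = P.h r * Real.cos (2 * a) := by
    apply mul_left_cancel₀ hD2
    rw [Real.cos_two_mul, Real.cos_sq', h2]
    linear_combination (-P.h' r * Real.sin θ) * h1
      - 2 * P.h r * P.h' r ^ 2 * (D * Real.sin a + Real.sin θ) * (-1) * hsin
      - 2 * P.h r * D ^ 2 * Real.sin a ^ 2 * hid
  have e3 : P.h' r * P.h' t + P.curvature * P.h r * Real.sin θ * P.h t = P.h' r := by
    apply mul_left_cancel₀ hD2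
    rw [h2]
    linear_combination (P.curvature * P.h r * Real.sin θ) * h1
      - 2 * P.curvature * P.h r ^ 2 * P.h' r * (D * Real.sin a + Real.sin θ) * hsin
  refine ⟨t, ht, ?_⟩
  rw [hγ]
  ext i
  fin_cases i
  · simp [geodesic, circlePoint, direction, Real.cos_add]
    linear_combination Real.cos φ * e2 - Real.sin φ * e1
  · simp [geodesic, circlePoint, direction, Real.sin_add]
    linear_combination Real.sin φ * e2 + Real.cos φ * e1
  · simp [geodesic, circlePoint, direction]
    linear_combination e3

theorem measurable_centralAngle (P : Plane) (r : ℝ) : Measurable (P.centralAngle r) := by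
  have h : Measurable fun θ : ℝ => (⟨P.h' r * Real.cos θ, Real.sin θ⟩ : ℂ) := by
    have : (fun θ : ℝ => (⟨P.h' r * Real.cos θ, Real.sin θ⟩ : ℂ)) =
        fun θ : ℝ => ((P.h' r * Real.cos θ : ℝ) : ℂ) + ((Real.sin θ : ℝ) : ℂ) * Complex.I := by
      ext θ; exact Complex.mk_eq_add_mul_I _ _
    rw [this]; fun_prop
  exact (Complex.measurable_arg.comp h).const_mul 2

/-- The representative of `s` in `[0, L)` modulo `L`, for `L > 0`. -/
noncomputable def modLength (L s : ℝ) : ℝ := L * Int.fract (s / L)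

/-- The deterministic circular billiard map `F(s, θ) = (s + l(γ(θ)) mod 2πh, θ)` in the arc
length coordinate `s ∈ [0, 2πh)` and the angle `θ ∈ [0, π]`. -/
noncomputable def billiardMap (P : Plane) (r : ℝ) (x : ℝ × ℝ) : ℝ × ℝ :=
  (modLength (P.length r) (x.1 + P.arcLength r (P.centralAngle r x.2)), x.2)

theorem measurable_billiardMap (P : Plane) (r : ℝ) : Measurable (P.billiardMap r) := by
  have h := P.measurable_centralAngle r
  unfold billiardMap modLength arcLength
  refine Measurable.prodMk (Measurable.const_mul (measurable_fract.comp ?_) _) measurable_snd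
  have h2 : Measurable fun x : ℝ × ℝ => P.centralAngle r x.2 := h.comp measurable_snd
  fun_prop

/-- The branches `F(s, T_i θ)` of the random circular billiard map. -/
noncomputable def randomBilliardMap (P : Plane) (r α : ℝ) (i : Fin 4) (x : ℝ × ℝ) : ℝ × ℝ :=
  P.billiardMap r (x.1, feresMap α i x.2)

/-- The transition probability kernel
`K((s, θ), E) = ∑ i, p_i θ * 1_E (F(s, T_i θ))` of the random circular billiard map. -/
noncomputable def billiardKernel (P : Plane) (r α : ℝ) : Kernel (ℝ × ℝ) (ℝ × ℝ) :=
  randomKernel (P.randomBilliardMap r α) (fun i x => feresProb α i x.2)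
    (fun i => (P.measurable_billiardMap r).comp
      (measurable_fst.prodMk ((measurable_feresMap α i).comp measurable_snd)))
    (fun i => (measurable_feresProb α i).comp measurable_snd)

/-- The normalized Lebesgue measure on `[0, 2πh)`. -/
noncomputable def positionMeasure (P : Plane) (r : ℝ) : Measure ℝ :=
  (ENNReal.ofReal (P.length r))⁻¹ • volume.restrict (Set.Ico 0 (P.length r))

end Plane

/-- The measure `μ(A) = (1/2) ∫_A sin θ dθ` on `[0, π]`. -/
noncomputable def angleMeasure : Measure ℝ :=
  (volume.restrict (Set.Icc 0 Real.pi)).withDensity fun θ => ENNReal.ofReal (Real.sin θ / 2)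

end CircularBilliard

/-!
The proof has two independent parts.

Each branch of the random billiard map turns the circle by an amount that depends on the angle
only, and normalized arc length is invariant under rotations. Hence one step maps `λ × ρ` to
`λ × ρ'`, where `ρ'` is the image of `ρ` under the Feres kernel
(`Plane.bind_billiardKernel_prod`). What remains is the convergence of `ν₂⁽ⁿ⁾(B)` to `μ(B)`.

The Feres kernel is reversible with respect to `μ`: the density `p_i(θ) sin θ` of the flow through
a branch equals that of the flow back through the inverse branch, where `T₁` and `T₃` are inverse
to each other and `T₂` and `T₄` are involutions (`flowDensity_ae_eq`). So its averaging operator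
`A f(θ) = ∑ p_i(θ) f(T_i θ)` is a symmetric contraction of `L²(μ)`. For any such operator
`⟨Aᵐ f, Aⁿ f⟩` depends on `m + n` only and `‖Aⁿ f‖` decreases, which makes `A²ⁿ f` a Cauchy
sequence. Its limit `φ` satisfies `‖A φ‖ = ‖φ‖`. As `‖φ‖² - ‖A φ‖²` is the mean variance of `φ`
over one transition, `φ` takes the same value at all points `T_i θ` with `p_i(θ) > 0`, for almost
every `θ`. If this forces `φ` to be constant, then `Aⁿ f` tends to `∫ f dμ` in mean square, and,
with `f = 1_B`, so does `ν₂⁽ⁿ⁾(B) = ∫ Aⁿ 1_B dν₂` to `μ(B)`, because `ν₂` is absolutely continuous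
(`tendsto_evolve_of_isReversible`). Excluding the eigenvalue `-1` along with nonconstant invariant
functions is what makes the measures themselves converge, and not only their averages.

It remains to see that such a `φ` is constant. Comparing `T₁` with `T₃` shows that `φ` has the
period `4α` on `(0, π)`. Comparing these with `T₄` near `0` and with `T₂` near `π` shows that the
periodic extension `ψ` of `φ` is symmetric about `α` and about `π - α`. The composition of the two
reflections is the translation by `2π - 4α`, so `ψ` has the period `2π` too
(`IsGeneric.periodic_add_two_pi`). Since `2π / (4α)` is irrational, the rotation by `2π` of the
circle `ℝ / 4αℤ` is ergodic, and `ψ` is constant (`ae_eq_const_of_constantAlong`).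
-/

namespace CircularBilliard

/-! ### Mixing of reversible Markov kernels -/

section Reversible

variable {X : Type*} [MeasurableSpace X]

/-- The averaging (Markov) operator of a kernel, acting on real functions. -/
noncomputable def avg (K : Kernel X X) (f : X → ℝ) : X → ℝ := fun x => ∫ y, f y ∂K x

variable {K : Kernel X X} {f h : X → ℝ} {M N : ℝ}

theorem measurable_avg (hf : Measurable f) : Measurable (avg K f) :=
  (hf.stronglyMeasurable.integral_kernel (κ := K)).measurable

theorem measurable_iterate_avg (hf : Measurable f) (n : ℕ) : Measurable ((avg K)^[n] f) := by
  induction n with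
  | zero => exact hf
  | succ n ih => rw [Function.iterate_succ_apply']; exact measurable_avg ih

variable [IsMarkovKernel K] {μ : Measure X} [IsProbabilityMeasure μ]

theorem norm_avg_le (hM : ∀ x, ‖f x‖ ≤ M) (x : X) : ‖avg K f x‖ ≤ M := by
  simpa [avg] using norm_integral_le_of_norm_le_const (μ := K x) (ae_of_all _ hM)

theorem norm_iterate_avg_le (hM : ∀ x, ‖f x‖ ≤ M) (n : ℕ) (x : X) :
    ‖(avg K)^[n] f x‖ ≤ M := by
  induction n generalizing x with
  | zero => exact hM x
  | succ n ih => rw [Function.iterate_succ_apply']; exact norm_avg_le ih x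

theorem integrable_of_norm_le {ρ : Measure X} [IsFiniteMeasure ρ] (hf : Measurable f)
    (hM : ∀ x, ‖f x‖ ≤ M) : Integrable f ρ :=
  Integrable.of_bound hf.aestronglyMeasurable M (ae_of_all _ hM)

theorem integrable_mul_of_norm_le {ρ : Measure X} [IsFiniteMeasure ρ] (hf : Measurable f)
    (hM : ∀ x, ‖f x‖ ≤ M) (hh : Measurable h) (hN : ∀ x, ‖h x‖ ≤ N) :
    Integrable (fun x => f x * h x) ρ := by
  refine integrable_of_norm_le (M := M * N) (hf.mul hh) fun x => ?_
  rw [norm_mul]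
  exact mul_le_mul (hM x) (hN x) (norm_nonneg _) ((norm_nonneg _).trans (hM x))

/-- Detailed balance for sets extends to the flow measure on `X × X`. -/
theorem map_swap_compProd_of_isReversible (hK : K.IsReversible μ) :
    (μ ⊗ₘ K).map Prod.swap = μ ⊗ₘ K := by
  refine Measure.ext_prod fun {A B} hA hB => ?_
  rw [Measure.map_apply measurable_swap (hA.prod hB), Set.preimage_swap_prod,
    Measure.compProd_apply_prod hB hA, Measure.compProd_apply_prod hA hB]
  exact hK hB hA

/-- The averaging operator of a reversible kernel is symmetric. -/
theorem integral_avg_mul (hK : K.IsReversible μ) (hf : Measurable f) (hM : ∀ x, ‖f x‖ ≤ M)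
    (hh : Measurable h) (hN : ∀ x, ‖h x‖ ≤ N) :
    ∫ x, avg K f x * h x ∂μ = ∫ x, f x * avg K h x ∂μ := by
  have i1 : Integrable (fun z : X × X => f z.2 * h z.1) (μ ⊗ₘ K) :=
    integrable_mul_of_norm_le (hf.comp measurable_snd) (fun z => hM z.2)
      (hh.comp measurable_fst) (fun z => hN z.1)
  have i2 : Integrable (fun z : X × X => f z.1 * h z.2) (μ ⊗ₘ K) :=
    integrable_mul_of_norm_le (hf.comp measurable_fst) (fun z => hM z.1)
      (hh.comp measurable_snd) (fun z => hN z.2)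
  have e1 := Measure.integral_compProd i1
  have e2 := Measure.integral_compProd i2
  simp only [integral_mul_const] at e1
  simp only [integral_const_mul] at e2
  calc ∫ x, avg K f x * h x ∂μ = ∫ z, f z.2 * h z.1 ∂(μ ⊗ₘ K) := e1.symm
    _ = ∫ z, f z.2 * h z.1 ∂((μ ⊗ₘ K).map Prod.swap) := by
        rw [map_swap_compProd_of_isReversible hK]
    _ = ∫ z, f z.1 * h z.2 ∂(μ ⊗ₘ K) := by
        rw [integral_map measurable_swap.aemeasurable]
        · rfl
        · exact ((hf.comp measurable_snd).mul (hh.comp measurable_fst)).aestronglyMeasurable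
    _ = ∫ x, f x * avg K h x ∂μ := e2

theorem integral_iterate_avg_mul (hK : K.IsReversible μ) (hf : Measurable f)
    (hM : ∀ x, ‖f x‖ ≤ M) (m n : ℕ) :
    ∫ x, (avg K)^[m] f x * (avg K)^[n] f x ∂μ = ∫ x, f x * (avg K)^[m + n] f x ∂μ := by
  induction m generalizing n with
  | zero => simp
  | succ m ih =>
    rw [Function.iterate_succ_apply', integral_avg_mul hK (measurable_iterate_avg hf m)
      (norm_iterate_avg_le hM m) (measurable_iterate_avg hf n) (norm_iterate_avg_le hM n),
      ← Function.iterate_succ_apply' (avg K) n f, ih, Nat.succ_add_eq_add_succ]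

theorem integral_avg (hK : K.IsReversible μ) (hf : Measurable f) (hM : ∀ x, ‖f x‖ ≤ M) :
    ∫ x, avg K f x ∂μ = ∫ x, f x ∂μ := by
  have := integral_avg_mul (h := fun _ => 1) (N := 1) hK hf hM measurable_const (by simp)
  simpa [avg] using this

theorem integral_iterate_avg (hK : K.IsReversible μ) (hf : Measurable f)
    (hM : ∀ x, ‖f x‖ ≤ M) (n : ℕ) : ∫ x, (avg K)^[n] f x ∂μ = ∫ x, f x ∂μ := by
  induction n with
  | zero => rfl
  | succ n ih =>
    rw [Function.iterate_succ_apply', integral_avg hK (measurable_iterate_avg hf n)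
      (norm_iterate_avg_le hM n), ih]

theorem integral_sub_const_sq {ρ : Measure X} [IsProbabilityMeasure ρ] (hf : Measurable f)
    (hM : ∀ x, ‖f x‖ ≤ M) (c : ℝ) :
    ∫ x, (f x - c) ^ 2 ∂ρ = ∫ x, f x * f x ∂ρ - 2 * c * ∫ x, f x ∂ρ + c * c := by
  have i1 : Integrable (fun x => 2 * c * f x) ρ := (integrable_of_norm_le hf hM).const_mul _
  have i2 : Integrable (fun x => f x * f x) ρ := integrable_mul_of_norm_le hf hM hf hM
  have i3 : Integrable (fun x => f x * f x - 2 * c * f x) ρ := i2.sub i1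
  have : ∀ x, (f x - c) ^ 2 = f x * f x - 2 * c * f x + c * c := fun x => by ring
  simp only [this]
  rw [integral_add i3 (integrable_const _), integral_sub i2 i1, integral_const_mul]
  simp

theorem integral_sub_avg_sq (hf : Measurable f) (hM : ∀ x, ‖f x‖ ≤ M) (x : X) :
    ∫ y, (f y - avg K f x) ^ 2 ∂K x = avg K (fun y => f y * f y) x - avg K f x * avg K f x := by
  rw [integral_sub_const_sq hf hM]
  simp only [avg]
  ring

/-- The loss of energy under the averaging operator is the mean variance of `f` under `K x`. -/
theorem integral_sq_sub_integral_avg_sq (hK : K.IsReversible μ) (hf : Measurable f)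
    (hM : ∀ x, ‖f x‖ ≤ M) :
    ∫ x, f x * f x ∂μ - ∫ x, avg K f x * avg K f x ∂μ =
      ∫ x, ∫ y, (f y - avg K f x) ^ 2 ∂K x ∂μ := by
  have hM2 : ∀ x, ‖f x * f x‖ ≤ M * M := fun x => by
    rw [norm_mul]; exact mul_self_le_mul_self (norm_nonneg _) (hM x)
  simp only [integral_sub_avg_sq hf hM]
  rw [← integral_avg hK (f := fun x => f x * f x) (hf.mul hf) hM2, ← integral_sub
    (integrable_of_norm_le (f := avg K fun x => f x * f x) (measurable_avg (hf.mul hf))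
      (norm_avg_le hM2))
    (integrable_mul_of_norm_le (measurable_avg hf) (norm_avg_le hM) (measurable_avg hf)
      (norm_avg_le hM))]

theorem integral_avg_sq_le (hK : K.IsReversible μ) (hf : Measurable f) (hM : ∀ x, ‖f x‖ ≤ M) :
    ∫ x, avg K f x * avg K f x ∂μ ≤ ∫ x, f x * f x ∂μ := by
  have := integral_sq_sub_integral_avg_sq hK hf hM
  have h2 : 0 ≤ ∫ x, ∫ y, (f y - avg K f x) ^ 2 ∂K x ∂μ :=
    integral_nonneg fun x => integral_nonneg fun y => sq_nonneg _
  linarith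

/-- If the averaging operator preserves the energy of `f`, then `f` is constant along almost
every transition. -/
theorem ae_ae_eq_avg_of_integral_sq_eq (hK : K.IsReversible μ) (hf : Measurable f)
    (hM : ∀ x, ‖f x‖ ≤ M)
    (he : ∫ x, avg K f x * avg K f x ∂μ = ∫ x, f x * f x ∂μ) :
    ∀ᵐ x ∂μ, ∀ᵐ y ∂K x, f y = avg K f x := by
  have h0 : ∫ x, ∫ y, (f y - avg K f x) ^ 2 ∂K x ∂μ = 0 := by
    rw [← integral_sq_sub_integral_avg_sq hK hf hM, he, sub_self]
  have hM2 : ∀ x, ‖f x * f x‖ ≤ M * M := fun x => by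
    rw [norm_mul]; exact mul_self_le_mul_self (norm_nonneg _) (hM x)
  have hi : Integrable (fun x => ∫ y, (f y - avg K f x) ^ 2 ∂K x) μ := by
    simp only [integral_sub_avg_sq hf hM]
    exact (integrable_of_norm_le (measurable_avg (hf.mul hf)) (norm_avg_le hM2)).sub
      (integrable_mul_of_norm_le (measurable_avg hf) (norm_avg_le hM) (measurable_avg hf)
      (norm_avg_le hM))
  rw [integral_eq_zero_iff_of_nonneg (fun x => integral_nonneg fun y => sq_nonneg _) hi] at h0
  filter_upwards [h0] with x hx
  have hb : ∀ y, ‖f y - avg K f x‖ ≤ M + M := fun y =>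
    (norm_sub_le _ _).trans (add_le_add (hM y) (norm_avg_le hM x))
  have hi2 : Integrable (fun y => (f y - avg K f x) ^ 2) (K x) := by
    simp only [sq]
    exact integrable_mul_of_norm_le (hf.sub_const _) hb (hf.sub_const _) hb
  have hx' := (integral_eq_zero_iff_of_nonneg (fun y => sq_nonneg _) hi2).1 hx
  filter_upwards [hx'] with y hy
  exact sub_eq_zero.1 (pow_eq_zero_iff two_ne_zero |>.1 hy)

/-- In a Hilbert space, a sequence of vectors of decreasing norm whose inner products form a
Hankel matrix converges along the even integers. -/
theorem exists_tendsto_of_inner_hankel {H : Type*} [NormedAddCommGroup H]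
    [InnerProductSpace ℝ H] [CompleteSpace H] {F : ℕ → H} {c : ℕ → ℝ}
    (hF : ∀ m n, inner ℝ (F m) (F n) = c (m + n)) (hanti : Antitone fun n => ‖F n‖ ^ 2) :
    ∃ Φ, Tendsto (fun n => F (2 * n)) atTop (𝓝 Φ) := by
  have hc : ∀ n, c (n + n) = ‖F n‖ ^ 2 := fun n => by rw [← hF, real_inner_self_eq_norm_sq]
  have hlim : ∃ b, Tendsto (fun n => ‖F n‖ ^ 2) atTop (𝓝 b) :=
    ⟨_, tendsto_atTop_ciInf hanti ⟨0, by rintro _ ⟨n, rfl⟩; positivity⟩⟩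
  obtain ⟨b, hb⟩ := hlim
  have hsq : ∀ m n, ‖F (2 * m) - F (2 * n)‖ ^ 2 =
      ‖F (2 * m)‖ ^ 2 - 2 * ‖F (m + n)‖ ^ 2 + ‖F (2 * n)‖ ^ 2 := fun m n => by
    rw [norm_sub_sq_real, hF, show 2 * m + 2 * n = (m + n) + (m + n) by ring, hc]
  refine cauchySeq_tendsto_of_complete (Metric.cauchySeq_iff'.2 fun ε hε => ?_)
  have h4 : 0 < ε ^ 2 / 4 := by positivity
  obtain ⟨n₀, hn₀⟩ := (Metric.tendsto_atTop.1 hb) _ h4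
  refine ⟨n₀, fun n hn => ?_⟩
  have h1 := abs_lt.1 (hn₀ (2 * n) (by lia))
  have h2 := abs_lt.1 (hn₀ (n + n₀) (by lia))
  have h3 := abs_lt.1 (hn₀ (2 * n₀) (by lia))
  rw [dist_eq_norm]
  refine lt_of_pow_lt_pow_left₀ 2 hε.le ?_
  rw [hsq]
  linarith [h1.2, h2.1, h3.2]

/-- If every measurable function which is constant along almost every transition of the
reversible kernel `K` is constant, then the iterates of a bounded function under the averaging
operator converge in mean square to its mean value. -/
theorem tendsto_integral_iterate_avg_sub_sq (hK : K.IsReversible μ)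
    (herg : ∀ φ : X → ℝ, Measurable φ → (∀ᵐ x ∂μ, ∃ c, ∀ᵐ y ∂K x, φ y = c) →
      ∃ c, ∀ᵐ x ∂μ, φ x = c)
    (hf : Measurable f) (hM : ∀ x, ‖f x‖ ≤ M) :
    Tendsto (fun n => ∫ x, ((avg K)^[n] f x - ∫ x, f x ∂μ) ^ 2 ∂μ) atTop (𝓝 0) := by
  set F : ℕ → X → ℝ := fun n => (avg K)^[n] f with hFdef
  have hFm : ∀ n, Measurable (F n) := measurable_iterate_avg hf
  have hFb : ∀ n x, ‖F n x‖ ≤ M := norm_iterate_avg_le hM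
  have hFs : ∀ n, F (n + 1) = avg K (F n) := fun n => Function.iterate_succ_apply' _ _ _
  have hp : ∀ n, MemLp (F n) 2 μ := fun n =>
    MemLp.of_bound (hFm n).aestronglyMeasurable M (ae_of_all _ (hFb n))
  let V : ℕ → Lp ℝ 2 μ := fun n => (hp n).toLp
  have hV : ∀ m n, inner ℝ (V m) (V n) = ∫ x, F m x * F n x ∂μ := fun m n => by
    rw [L2.inner_def]
    refine integral_congr_ae ?_
    filter_upwards [(hp m).coeFn_toLp, (hp n).coeFn_toLp] with x h1 h2
    simp only [V, h1, h2, RCLike.inner_apply, conj_trivial, mul_comm]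
  have hVn : ∀ n, ‖V n‖ ^ 2 = ∫ x, F n x * F n x ∂μ := fun n => by
    rw [← real_inner_self_eq_norm_sq, hV]
  have hanti : Antitone fun n => ‖V n‖ ^ 2 := antitone_nat_of_succ_le fun n => by
    rw [hVn, hVn, hFs]; exact integral_avg_sq_le hK (hFm n) (hFb n)
  obtain ⟨Φ, hΦ⟩ := exists_tendsto_of_inner_hankel
    (c := fun k => ∫ x, f x * F k x ∂μ)
    (fun m n => (hV m n).trans (integral_iterate_avg_mul hK hf hM m n)) hanti
  obtain ⟨b, hb⟩ : ∃ b, Tendsto (fun n => ∫ x, F n x * F n x ∂μ) atTop (𝓝 b) := by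
    simp only [← hVn]
    exact ⟨_, tendsto_atTop_ciInf hanti ⟨0, by rintro _ ⟨n, rfl⟩; positivity⟩⟩
  -- a subsequence converges almost everywhere, to a limit that may be taken bounded by `M`
  have hmeas : TendstoInMeasure μ (fun n => F (2 * n)) atTop Φ := by
    have h1 := tendstoInMeasure_of_tendsto_Lp hΦ
    exact h1.congr_left fun n => (hp (2 * n)).coeFn_toLp
  obtain ⟨ns, hns, hae⟩ := hmeas.exists_seq_tendsto_ae
  set φ : X → ℝ := fun x => max (-M) (min M (Φ x)) with hφ
  have hφm : Measurable φ :=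
    measurable_const.max (measurable_const.min (Lp.stronglyMeasurable Φ).measurable)
  obtain ⟨x₀⟩ : Nonempty X := nonempty_of_isProbabilityMeasure μ
  have hM0 : 0 ≤ M := (norm_nonneg _).trans (hM x₀)
  have hφb : ∀ x, ‖φ x‖ ≤ M := fun x => by
    rw [Real.norm_eq_abs, abs_le]
    exact ⟨le_max_left _ _, max_le (by linarith) (min_le_left _ _)⟩
  have hlim : ∀ᵐ x ∂μ, Tendsto (fun k => F (2 * ns k) x) atTop (𝓝 (φ x)) := by
    filter_upwards [hae] with x hx
    have h2 : ∀ k, F (2 * ns k) x = max (-M) (min M (F (2 * ns k) x)) := fun k => by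
      have := abs_le.1 (hFb (2 * ns k) x)
      rw [min_eq_right this.2, max_eq_right this.1]
    have h3 : Tendsto (fun k => max (-M) (min M (F (2 * ns k) x))) atTop (𝓝 (φ x)) :=
      tendsto_const_nhds.max (tendsto_const_nhds.min hx)
    exact h3.congr fun k => (h2 k).symm
  -- by dominated convergence, `φ` and its average have the same energy
  have hsq : ∀ {G : ℕ → X → ℝ} {ψ : X → ℝ}, (∀ k, Measurable (G k)) →
      (∀ k x, ‖G k x‖ ≤ M) → (∀ᵐ x ∂μ, Tendsto (fun k => G k x) atTop (𝓝 (ψ x))) →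
      Tendsto (fun k => ∫ x, G k x * G k x ∂μ) atTop (𝓝 (∫ x, ψ x * ψ x ∂μ)) := by
    intro G ψ hGm hGb hG
    refine tendsto_integral_of_dominated_convergence (fun _ => M * M)
      (fun k => ((hGm k).mul (hGm k)).aestronglyMeasurable) (integrable_const _)
      (fun k => ae_of_all _ fun x => ?_) ?_
    · rw [norm_mul]; exact mul_self_le_mul_self (norm_nonneg _) (hGb k x)
    · filter_upwards [hG] with x hx using hx.mul hx
  have hnst := hns.tendsto_atTop
  have hns2 : Tendsto (fun k => 2 * ns k) atTop atTop :=
    tendsto_atTop_mono (fun k => by lia) hnst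
  have hlim' : ∀ᵐ x ∂μ, Tendsto (fun k => F (2 * ns k + 1) x) atTop (𝓝 (avg K φ x)) := by
    have h1 : ∀ᵐ x ∂(μ.bind K), Tendsto (fun k => F (2 * ns k) x) atTop (𝓝 (φ x)) := by
      rw [hK.invariant.def]; exact hlim
    filter_upwards [Measure.ae_ae_of_ae_comp h1] with x hx
    simp only [hFs]
    exact tendsto_integral_of_dominated_convergence (fun _ => M)
      (fun k => (hFm _).aestronglyMeasurable) (integrable_const _)
      (fun k => ae_of_all _ (hFb _)) hx
  have e1 : ∫ x, φ x * φ x ∂μ = b :=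
    tendsto_nhds_unique (hsq (fun k => hFm _) (fun k => hFb _) hlim) (hb.comp hns2)
  have e2 : ∫ x, avg K φ x * avg K φ x ∂μ = b :=
    tendsto_nhds_unique (hsq (fun k => hFm _) (fun k => hFb _) hlim')
      (hb.comp ((tendsto_add_atTop_nat 1).comp hns2))
  have hconst := ae_ae_eq_avg_of_integral_sq_eq hK hφm hφb (e2.trans e1.symm)
  obtain ⟨c, hc⟩ := herg φ hφm (hconst.mono fun x hx => ⟨_, hx⟩)
  -- the constant is the mean of `f`
  have hcm : ∫ x, f x ∂μ = c := by
    have h1 : Tendsto (fun k => ∫ x, F (2 * ns k) x ∂μ) atTop (𝓝 (∫ x, φ x ∂μ)) :=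
      tendsto_integral_of_dominated_convergence (fun _ => M)
        (fun k => (hFm _).aestronglyMeasurable) (integrable_const _)
        (fun k => ae_of_all _ (hFb _)) hlim
    have h2 : ∫ x, φ x ∂μ = c := by rw [integral_congr_ae hc]; simp
    have h3 : ∀ n, ∫ x, F n x ∂μ = ∫ x, f x ∂μ := integral_iterate_avg hK hf hM
    simp only [h3] at h1
    rw [← h2]; exact tendsto_nhds_unique tendsto_const_nhds h1
  have hbc : b = c * c := by
    rw [← e1, integral_congr_ae (hc.mono fun x hx => by simp only [hx] : _ =ᵐ[μ] fun _ => c * c)]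
    simp
  have hexp : ∀ n, ∫ x, (F n x - ∫ x, f x ∂μ) ^ 2 ∂μ = ∫ x, F n x * F n x ∂μ - b := fun n => by
    have h3 : ∫ x, F n x ∂μ = c := (integral_iterate_avg hK hf hM n).trans hcm
    rw [hcm, integral_sub_const_sq (hFm n) (hFb n), h3, hbc]
    ring
  refine Tendsto.congr (fun n => (hexp n).symm) ?_
  simpa using hb.sub_const b

instance isProbabilityMeasure_evolve (ν : Measure X) [IsProbabilityMeasure ν] (n : ℕ) :
    IsProbabilityMeasure (evolve K ν n) := by
  induction n with
  | zero => assumption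
  | succ n ih => exact inferInstanceAs (IsProbabilityMeasure ((evolve K ν n).bind K))

theorem integral_evolve {ν : Measure X} [IsProbabilityMeasure ν] (hf : Measurable f)
    (hM : ∀ x, ‖f x‖ ≤ M) (n : ℕ) :
    ∫ x, f x ∂(evolve K ν n) = ∫ x, (avg K)^[n] f x ∂ν := by
  induction n generalizing f with
  | zero => rfl
  | succ n ih =>
    have h1 : ∫ x, f x ∂((evolve K ν n).bind K) = ∫ x, avg K f x ∂(evolve K ν n) := by
      rw [← Measure.snd_compProd, Measure.snd, integral_map measurable_snd.aemeasurable
        hf.aestronglyMeasurable, Measure.integral_compProd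
        (integrable_of_norm_le (f := fun z : X × X => f z.2) (hf.comp measurable_snd)
          fun z => hM z.2)]
      rfl
    rw [evolve, h1, ih (measurable_avg hf) (norm_avg_le hM), Function.iterate_succ_apply]

/-- A reversible kernel for which only the constants are constant along almost every transition
is mixing: every absolutely continuous initial distribution converges setwise to `μ`. -/
theorem tendsto_evolve_of_isReversible (hK : K.IsReversible μ)
    (herg : ∀ φ : X → ℝ, Measurable φ → (∀ᵐ x ∂μ, ∃ c, ∀ᵐ y ∂K x, φ y = c) →
      ∃ c, ∀ᵐ x ∂μ, φ x = c)
    {ν : Measure X} [IsProbabilityMeasure ν] (hν : ν ≪ μ) {B : Set X} (hB : MeasurableSet B) :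
    Tendsto (fun n => evolve K ν n B) atTop (𝓝 (μ B)) := by
  set f : X → ℝ := B.indicator 1 with hfdef
  have hf : Measurable f := measurable_one.indicator hB
  have hM : ∀ x, ‖f x‖ ≤ 1 := fun x => by
    by_cases hx : x ∈ B <;> simp [hfdef, hx]
  set F : ℕ → X → ℝ := fun n => (avg K)^[n] f with hFdef
  have hFm : ∀ n, Measurable (F n) := measurable_iterate_avg hf
  have hFb : ∀ n x, ‖F n x‖ ≤ 1 := norm_iterate_avg_le hM
  have hL2 := tendsto_integral_iterate_avg_sub_sq hK herg hf hM
  set c := ∫ x, f x ∂μ with hc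
  -- convergence in mean square gives convergence of the integrals against `ν`
  have hmain : Tendsto (fun n => ∫ x, F n x ∂ν) atTop (𝓝 c) := by
    refine tendsto_of_subseq_tendsto fun ms hms => ?_
    have hsub : TendstoInMeasure μ (fun n x => F (ms n) x) atTop (fun _ => c) := by
      have hint : Tendsto (fun n => ∫ x, (F (ms n) x - c) ^ 2 ∂μ) atTop (𝓝 0) := hL2.comp hms
      have hLp : Tendsto (fun n => eLpNorm ((fun x => F (ms n) x) - fun _ => c) 2 μ) atTop
          (𝓝 0) := by
        have h2 : ∀ n, eLpNorm ((fun x => F (ms n) x) - fun _ => c) 2 μ =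
            ENNReal.ofReal ((∫ x, (F (ms n) x - c) ^ 2 ∂μ) ^ (1 / 2 : ℝ)) := fun n => by
          rw [MemLp.eLpNorm_eq_integral_rpow_norm two_ne_zero ENNReal.ofNat_ne_top]
          · simp
          · exact MemLp.sub (MemLp.of_bound (hFm _).aestronglyMeasurable 1 (ae_of_all _ (hFb _)))
              (memLp_const c)
        simp only [h2]
        have h3 := (ENNReal.continuous_ofReal.tendsto _).comp
          (hint.rpow_const (p := 1 / 2) (Or.inr (by norm_num)))
        simpa [Function.comp_def] using h3
      exact tendstoInMeasure_of_tendsto_eLpNorm two_ne_zero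
        (fun n => (hFm _).aestronglyMeasurable) aestronglyMeasurable_const hLp
    obtain ⟨ks, -, hks⟩ := hsub.exists_seq_tendsto_ae
    refine ⟨ks, ?_⟩
    have h1 : Tendsto (fun k => ∫ x, F (ms (ks k)) x ∂ν) atTop (𝓝 (∫ _, c ∂ν)) :=
      tendsto_integral_of_dominated_convergence (fun _ => 1)
        (fun k => (hFm _).aestronglyMeasurable) (integrable_const _)
        (fun k => ae_of_all _ (hFb _)) (hν.ae_le hks)
    simpa using h1
  have h1 : ∀ n, ENNReal.ofReal (∫ x, F n x ∂ν) = evolve K ν n B := fun n => by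
    rw [← integral_evolve hf hM, integral_indicator_one hB, ofReal_measureReal]
  have h2 : ENNReal.ofReal c = μ B := by
    rw [hc, integral_indicator_one hB, ofReal_measureReal]
  rw [← h2]
  simp only [← h1]
  exact (ENNReal.continuous_ofReal.tendsto _).comp hmain

end Reversible

/-! ### The position stays uniform and independent of the angle -/

section RandomKernel

variable {X : Type*} [MeasurableSpace X] {N : ℕ} {T : Fin N → X → X} {p : Fin N → X → ℝ}
  (hT : ∀ i, Measurable (T i)) (hp : ∀ i, Measurable (p i))

theorem randomKernel_apply (x : X) :
    randomKernel T p hT hp x = ∑ i, ENNReal.ofReal (p i x) • Measure.dirac (T i x) := rfl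

theorem lintegral_randomKernel {f : X → ℝ≥0∞} (hf : Measurable f) (x : X) :
    ∫⁻ y, f y ∂randomKernel T p hT hp x = ∑ i, ENNReal.ofReal (p i x) * f (T i x) := by
  simp only [randomKernel_apply, lintegral_finsetSum_measure, lintegral_smul_measure,
    lintegral_dirac' _ hf, smul_eq_mul]

theorem randomKernel_apply_set {A : Set X} (hA : MeasurableSet A) (x : X) :
    randomKernel T p hT hp x A = ∑ i, ENNReal.ofReal (p i x) * A.indicator 1 (T i x) := by
  rw [← lintegral_indicator_one hA, lintegral_randomKernel hT hp (measurable_one.indicator hA)]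

instance isSFiniteKernel_randomKernel : IsSFiniteKernel (randomKernel T p hT hp) := by
  have : randomKernel T p hT hp = ∑ i, (Kernel.deterministic (T i) (hT i)).withDensity
      fun x _ => ENNReal.ofReal (p i x) := by
    ext x A hA
    rw [randomKernel_apply_set hT hp hA, Kernel.finsetSum_apply']
    refine Finset.sum_congr rfl fun i _ => ?_
    rw [Kernel.withDensity_apply' _ (by have := hp i; fun_prop), Kernel.deterministic_apply,
      setLIntegral_const, Measure.dirac_apply' _ hA]
  rw [this]
  exact Kernel.IsSFiniteKernel.finsetSum _ fun i _ =>
    Kernel.IsSFiniteKernel.withDensity _ fun _ _ => ENNReal.ofReal_ne_top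

end RandomKernel

theorem volume_modLength_add_preimage {L : ℝ} (hL : 0 < L) (t : ℝ) {A : Set ℝ}
    (hA : MeasurableSet A) :
    volume.restrict (Set.Ico 0 L) {s | Plane.modLength L (s + t) ∈ A} =
      volume.restrict (Set.Ico 0 L) A := by
  have hmeas : Measurable (Plane.modLength L) := by unfold Plane.modLength; fun_prop
  set D : Set ℝ := Plane.modLength L ⁻¹' A with hD
  have hDm : MeasurableSet D := hmeas hA
  have hinv : ∀ g : AddSubgroup.zmultiples L, (fun x => g +ᵥ x) ⁻¹' D = D := by
    rintro ⟨_, n, rfl⟩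
    ext x
    have : Plane.modLength L (n • L + x) = Plane.modLength L x := by
      simp only [Plane.modLength, zsmul_eq_mul]
      rw [add_div, mul_div_cancel_right₀ _ hL.ne', Int.fract_intCast_add]
    change Plane.modLength L (n • L + x) ∈ A ↔ Plane.modLength L x ∈ A
    rw [this]
  have hfund := (isAddFundamentalDomain_Ioc hL t).measure_set_eq
    (isAddFundamentalDomain_Ioc hL 0) hDm hinv
  have hIco : ∀ a : ℝ, volume (D ∩ Set.Ico a (a + L)) = volume (D ∩ Set.Ioc a (a + L)) :=
    fun a => measure_congr ((ae_eq_refl D).inter Ico_ae_eq_Ioc)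
  have h1 : {s | Plane.modLength L (s + t) ∈ A} ∩ Set.Ico 0 L =
      (fun s => s + t) ⁻¹' (D ∩ Set.Ico t (t + L)) := by
    ext s
    simp only [hD, Set.mem_inter_iff, Set.mem_ofPred_eq, Set.mem_Ico, Set.mem_preimage]
    constructor <;> rintro ⟨h, h2, h3⟩ <;> exact ⟨h, by linarith, by linarith⟩
  have h2 : D ∩ Set.Ico 0 (0 + L) = A ∩ Set.Ico 0 L := by
    ext s
    simp only [zero_add, Set.mem_inter_iff, and_congr_left_iff, hD, Set.mem_preimage]
    rintro ⟨h0, h1⟩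
    have : Plane.modLength L s = s := by
      rw [Plane.modLength, Int.fract_eq_self.2 ⟨by positivity, (div_lt_one hL).2 h1⟩]
      field_simp
    rw [this]
  rw [Measure.restrict_apply' measurableSet_Ico, Measure.restrict_apply' measurableSet_Ico, h1,
    measure_preimage_add_right, hIco, hfund, ← hIco, h2]

namespace Plane

theorem length_pos (P : Plane) {r : ℝ} (hr : P.IsRadius r) : 0 < P.length r := by
  have : 0 < P.h r := by
    cases P
    · exact hr
    · exact Real.sinh_pos_iff.2 hr
    · exact Real.sin_pos_of_pos_of_lt_pi hr.1 hr.2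
  unfold length; positivity

instance isFiniteMeasure_positionMeasure (P : Plane) (r : ℝ) :
    IsFiniteMeasure (P.positionMeasure r) := by
  by_cases h : 0 < P.length r
  · refine ⟨?_⟩
    rw [positionMeasure, Measure.smul_apply, smul_eq_mul]
    exact ENNReal.mul_lt_top (by simpa using h) (measure_lt_top _ _)
  · have : P.positionMeasure r = 0 := by
      rw [positionMeasure, Set.Ico_eq_empty (by simpa using h)]; simp
    rw [this]; infer_instance

/-- The normalized Lebesgue measure of the circle is invariant under rotations. -/
theorem positionMeasure_modLength_add (P : Plane) {r : ℝ} (hr : P.IsRadius r) (t : ℝ)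
    {A : Set ℝ} (hA : MeasurableSet A) :
    P.positionMeasure r {s | modLength (P.length r) (s + t) ∈ A} = P.positionMeasure r A := by
  simp only [positionMeasure, Measure.smul_apply]
  rw [volume_modLength_add_preimage (P.length_pos hr) t hA]

/-- One step of the random billiard keeps the position uniform and independent of the angle:
each branch rotates the circle by an amount that depends on the angle only. -/
theorem bind_billiardKernel_prod (P : Plane) {r : ℝ} (hr : P.IsRadius r) (α : ℝ)
    (ρ : Measure ℝ) [SFinite ρ] :
    ((P.positionMeasure r).prod ρ).bind (P.billiardKernel r α) =
      (P.positionMeasure r).prod (ρ.bind (feresKernel α)) := by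
  have : IsSFiniteKernel (feresKernel α) := by unfold feresKernel; infer_instance
  ext E hE
  have hslice : ∀ θ, MeasurableSet ((fun s : ℝ => (s, θ)) ⁻¹' E) := fun θ =>
    measurable_prodMk_right hE
  have hm : Measurable fun θ => P.positionMeasure r ((fun s : ℝ => (s, θ)) ⁻¹' E) :=
    measurable_measure_prodMk_right hE
  rw [Measure.bind_apply hE (Kernel.aemeasurable _),
    lintegral_prod_symm _ (Kernel.measurable_coe _ hE).aemeasurable, Measure.prod_apply_symm hE,
    Measure.lintegral_bind (Kernel.aemeasurable _) hm.aemeasurable]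
  refine lintegral_congr fun θ => ?_
  rw [feresKernel, lintegral_randomKernel _ _ hm]
  have hK : ∀ s, P.billiardKernel r α (s, θ) E = ∑ i, ENNReal.ofReal (feresProb α i θ) *
      E.indicator 1 (P.randomBilliardMap r α i (s, θ)) := fun s =>
    randomKernel_apply_set _ _ hE _
  simp only [hK]
  have hbm : ∀ i, Measurable fun s : ℝ => P.randomBilliardMap r α i (s, θ) := fun i =>
    (P.measurable_billiardMap r).comp
      (measurable_id.prodMk (measurable_const (a := feresMap α i θ)))
  have hind : ∀ i, Measurable fun s : ℝ =>
      E.indicator (1 : ℝ × ℝ → ℝ≥0∞) (P.randomBilliardMap r α i (s, θ)) := fun i =>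
    (measurable_one.indicator hE).comp (hbm i)
  rw [lintegral_finsetSum _ fun i _ => (hind i).const_mul _]
  refine Finset.sum_congr rfl fun i _ => ?_
  rw [lintegral_const_mul _ (hind i)]
  congr 1
  have h1 : ∀ s : ℝ, E.indicator (1 : ℝ × ℝ → ℝ≥0∞) (P.randomBilliardMap r α i (s, θ)) =
      ((fun s => P.randomBilliardMap r α i (s, θ)) ⁻¹' E).indicator 1 s := fun s => rfl
  simp only [h1]
  rw [lintegral_indicator_one (hbm i hE)]
  exact P.positionMeasure_modLength_add hr
    (P.arcLength r (P.centralAngle r (feresMap α i θ))) (hslice (feresMap α i θ))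

theorem evolve_billiardKernel (P : Plane) {r : ℝ} (hr : P.IsRadius r) (α : ℝ)
    (ν₂ : Measure ℝ) [SFinite ν₂] (n : ℕ) :
    evolve (P.billiardKernel r α) ((P.positionMeasure r).prod ν₂) n =
      (P.positionMeasure r).prod (evolve (feresKernel α) ν₂ n) := by
  have : IsSFiniteKernel (feresKernel α) := by unfold feresKernel; infer_instance
  have hs : ∀ n, SFinite (evolve (feresKernel α) ν₂ n) := fun n => by
    induction n with
    | zero => assumption
    | succ n ih => exact inferInstanceAs (SFinite ((evolve (feresKernel α) ν₂ n).bind _))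
  induction n with
  | zero => rfl
  | succ n ih =>
    have := hs n
    rw [evolve, ih, P.bind_billiardKernel_prod hr]
    rfl

end Plane

/-! ### The probabilities of the Feres map -/

theorem u_neg (a θ : ℝ) : u a (-θ) = 1 - u a θ := by
  simp only [u, Real.tan_neg, div_neg]; ring

theorem u_mul_sin {a θ : ℝ} (ha : Real.cos a ≠ 0) (hθ : Real.sin θ ≠ 0) :
    u a θ * Real.sin θ = Real.sin (θ + a) / (2 * Real.cos a) := by
  have h : Real.tan a / Real.tan θ = Real.sin a * Real.cos θ / (Real.cos a * Real.sin θ) := by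
    rw [Real.tan_eq_sin_div_cos, Real.tan_eq_sin_div_cos, div_div_div_eq]
  rw [u, h, Real.sin_add]
  field_simp

theorem u_neg_mul_sin {a θ : ℝ} (ha : Real.cos a ≠ 0) (hθ : Real.sin θ ≠ 0) :
    u a (-θ) * Real.sin θ = Real.sin (θ - a) / (2 * Real.cos a) := by
  have h := u_mul_sin (θ := -θ) ha (by simpa using hθ)
  rw [Real.sin_neg, show -θ + a = -(θ - a) by ring, Real.sin_neg, neg_div] at h
  linarith

/-- The density `p_i(θ) sin θ`, for `θ ∈ (0, π)`, of the flow through each of the four branches,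
in a closed form without the singularities of `u`. -/
noncomputable def flow (α : ℝ) : Fin 4 → ℝ → ℝ :=
  ![fun θ =>
      if θ < α then Real.sin θ
      else if θ < Real.pi - 3 * α then Real.sin (θ + α) / (2 * Real.cos α)
      else if θ < Real.pi - 2 * α then Real.sin (θ + 2 * α)
      else 0,
    fun θ =>
      if θ < Real.pi - 3 * α then 0
      else if θ < Real.pi - 2 * α then -Real.sin (θ + 3 * α) / (2 * Real.cos α)
      else if θ < Real.pi - α then Real.sin (θ + α) / (2 * Real.cos α)
      else 0,
    fun θ =>
      if θ < 2 * α then 0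
      else if θ < 3 * α then Real.sin (θ - 2 * α)
      else if θ < Real.pi - α then Real.sin (θ - α) / (2 * Real.cos α)
      else Real.sin θ,
    fun θ =>
      if θ < α then 0
      else if θ < 2 * α then Real.sin (θ - α) / (2 * Real.cos α)
      else if θ < 3 * α then Real.sin (3 * α - θ) / (2 * Real.cos α)
      else 0]

variable {α : ℝ}

theorem sum_feresProb (hα₀ : 0 < α) (hα₁ : α < Real.pi / 6) (θ : ℝ) :
    ∑ i, feresProb α i θ = 1 := by
  simp only [Fin.sum_univ_four, feresProb, Matrix.cons_val, u_neg]
  split_ifs <;> linarith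

theorem feresProb_mul_sin (hα₀ : 0 < α) (hα₁ : α < Real.pi / 6) {θ : ℝ}
    (hθ : θ ∈ Set.Ioo 0 Real.pi) (i : Fin 4) :
    feresProb α i θ * Real.sin θ = flow α i θ := by
  have hs : Real.sin θ ≠ 0 := (Real.sin_pos_of_mem_Ioo hθ).ne'
  have hc1 : Real.cos α ≠ 0 :=
    (Real.cos_pos_of_mem_Ioo ⟨by linarith, by linarith⟩).ne'
  have hc2 : Real.cos (2 * α) ≠ 0 :=
    (Real.cos_pos_of_mem_Ioo ⟨by linarith, by linarith⟩).ne'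
  have a1 := u_mul_sin hc1 hs
  have a2 := u_neg_mul_sin hc1 hs
  have b1 : 2 * Real.cos (2 * α) * u (2 * α) θ * Real.sin θ = Real.sin (θ + 2 * α) := by
    rw [mul_assoc, u_mul_sin hc2 hs]; field_simp
  have b2 : 2 * Real.cos (2 * α) * u (2 * α) (-θ) * Real.sin θ = Real.sin (θ - 2 * α) := by
    rw [mul_assoc, u_neg_mul_sin hc2 hs]; field_simp
  have c1 : (u α θ - 2 * Real.cos (2 * α) * u (2 * α) θ) * Real.sin θ =
      -Real.sin (θ + 3 * α) / (2 * Real.cos α) := by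
    rw [sub_mul, a1, b1]
    have h1 : Real.sin (θ + α) = Real.sin (θ + 2 * α) * Real.cos α -
        Real.cos (θ + 2 * α) * Real.sin α := by
      rw [← Real.sin_sub]; congr 1; ring
    have h2 : Real.sin (θ + 3 * α) = Real.sin (θ + 2 * α) * Real.cos α +
        Real.cos (θ + 2 * α) * Real.sin α := by
      rw [← Real.sin_add]; congr 1; ring
    rw [h1, h2]; field_simp; ring
  have c2 : (u α (-θ) - 2 * Real.cos (2 * α) * u (2 * α) (-θ)) * Real.sin θ =
      Real.sin (3 * α - θ) / (2 * Real.cos α) := by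
    rw [sub_mul, a2, b2]
    have h1 : Real.sin (θ - α) = Real.sin (θ - 2 * α) * Real.cos α +
        Real.cos (θ - 2 * α) * Real.sin α := by
      rw [← Real.sin_add]; congr 1; ring
    have h2 : Real.sin (3 * α - θ) = -(Real.sin (θ - 2 * α) * Real.cos α -
        Real.cos (θ - 2 * α) * Real.sin α) := by
      rw [← Real.sin_sub, ← Real.sin_neg]; congr 1; ring
    rw [h1, h2]; field_simp; ring
  fin_cases i
  · simp only [feresProb, flow, Fin.zero_eta, Matrix.cons_val]
    split_ifs <;> simp only [one_mul, zero_mul, a1, b1]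
  · simp only [feresProb, flow, Fin.mk_one, Matrix.cons_val]
    split_ifs <;> simp only [zero_mul, a1, c1]
  · simp only [feresProb, flow, Fin.reduceFinMk, Matrix.cons_val]
    split_ifs <;> simp only [one_mul, zero_mul, a2, b2]
  · simp only [feresProb, flow, Fin.reduceFinMk, Matrix.cons_val]
    split_ifs <;> simp only [zero_mul, a2, c2]

theorem neg_sin_eq_sin_sub_pi (x : ℝ) : -Real.sin x = Real.sin (x - Real.pi) :=
  (Real.sin_sub_pi x).symm

theorem flow_nonneg (hα₀ : 0 < α) (hα₁ : α < Real.pi / 6) {θ : ℝ}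
    (hθ : θ ∈ Set.Ioo 0 Real.pi) (i : Fin 4) : 0 ≤ flow α i θ := by
  obtain ⟨h0, h1⟩ := hθ
  have hc : 0 ≤ 2 * Real.cos α :=
    mul_nonneg zero_le_two (Real.cos_nonneg_of_mem_Icc ⟨by linarith, by linarith⟩)
  fin_cases i
  · simp only [flow, Fin.zero_eta, Matrix.cons_val]
    split_ifs <;>
      first
      | exact le_rfl
      | exact Real.sin_nonneg_of_nonneg_of_le_pi (by linarith) (by linarith)
      | exact div_nonneg (Real.sin_nonneg_of_nonneg_of_le_pi (by linarith) (by linarith)) hc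
  · simp only [flow, Fin.mk_one, Matrix.cons_val, neg_sin_eq_sin_sub_pi]
    split_ifs <;>
      first
      | exact le_rfl
      | exact div_nonneg (Real.sin_nonneg_of_nonneg_of_le_pi (by linarith) (by linarith)) hc
  · simp only [flow, Fin.reduceFinMk, Matrix.cons_val]
    split_ifs <;>
      first
      | exact le_rfl
      | exact Real.sin_nonneg_of_nonneg_of_le_pi (by linarith) (by linarith)
      | exact div_nonneg (Real.sin_nonneg_of_nonneg_of_le_pi (by linarith) (by linarith)) hc
  · simp only [flow, Fin.reduceFinMk, Matrix.cons_val]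
    split_ifs <;>
      first
      | exact le_rfl
      | exact div_nonneg (Real.sin_nonneg_of_nonneg_of_le_pi (by linarith) (by linarith)) hc

theorem feresProb_nonneg (hα₀ : 0 < α) (hα₁ : α < Real.pi / 6) {θ : ℝ}
    (hθ : θ ∈ Set.Ioo 0 Real.pi) (i : Fin 4) : 0 ≤ feresProb α i θ := by
  have h1 := flow_nonneg hα₀ hα₁ hθ i
  rw [← feresProb_mul_sin hα₀ hα₁ hθ] at h1
  exact nonneg_of_mul_nonneg_left h1 (Real.sin_pos_of_mem_Ioo hθ)

theorem feresProb_pos_of_flow_pos (hα₀ : 0 < α) (hα₁ : α < Real.pi / 6) {θ : ℝ}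
    (hθ : θ ∈ Set.Ioo 0 Real.pi) {i : Fin 4} (h : 0 < flow α i θ) : 0 < feresProb α i θ := by
  rw [← feresProb_mul_sin hα₀ hα₁ hθ] at h
  exact pos_of_mul_pos_left h (Real.sin_pos_of_mem_Ioo hθ).le

theorem feresProb_zero_pos (hα₀ : 0 < α) (hα₁ : α < Real.pi / 6) {θ : ℝ}
    (h0 : 0 < θ) (h1 : θ < Real.pi - 2 * α) : 0 < feresProb α 0 θ := by
  have hc : 0 < 2 * Real.cos α :=
    mul_pos zero_lt_two (Real.cos_pos_of_mem_Ioo ⟨by linarith, by linarith⟩)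
  refine feresProb_pos_of_flow_pos hα₀ hα₁ ⟨h0, by linarith⟩ ?_
  simp only [flow, Matrix.cons_val]
  split_ifs <;>
    first
    | exact Real.sin_pos_of_pos_of_lt_pi (by linarith) (by linarith)
    | exact div_pos (Real.sin_pos_of_pos_of_lt_pi (by linarith) (by linarith)) hc

theorem feresProb_one_pos (hα₀ : 0 < α) (hα₁ : α < Real.pi / 6) {θ : ℝ}
    (h0 : Real.pi - 3 * α < θ) (h1 : θ < Real.pi - α) : 0 < feresProb α 1 θ := by
  have hc : 0 < 2 * Real.cos α :=
    mul_pos zero_lt_two (Real.cos_pos_of_mem_Ioo ⟨by linarith, by linarith⟩)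
  refine feresProb_pos_of_flow_pos hα₀ hα₁ ⟨by linarith, by linarith⟩ ?_
  simp only [flow, Matrix.cons_val, neg_sin_eq_sin_sub_pi]
  split_ifs <;>
    first
    | linarith
    | exact div_pos (Real.sin_pos_of_pos_of_lt_pi (by linarith) (by linarith)) hc

theorem feresProb_two_pos (hα₀ : 0 < α) (hα₁ : α < Real.pi / 6) {θ : ℝ}
    (h0 : 2 * α < θ) (h1 : θ < Real.pi) : 0 < feresProb α 2 θ := by
  have hc : 0 < 2 * Real.cos α :=
    mul_pos zero_lt_two (Real.cos_pos_of_mem_Ioo ⟨by linarith, by linarith⟩)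
  refine feresProb_pos_of_flow_pos hα₀ hα₁ ⟨by linarith, h1⟩ ?_
  simp only [flow, Matrix.cons_val]
  split_ifs <;>
    first
    | linarith
    | exact Real.sin_pos_of_pos_of_lt_pi (by linarith) (by linarith)
    | exact div_pos (Real.sin_pos_of_pos_of_lt_pi (by linarith) (by linarith)) hc

theorem feresProb_three_pos (hα₀ : 0 < α) (hα₁ : α < Real.pi / 6) {θ : ℝ}
    (h0 : α < θ) (h1 : θ < 3 * α) : 0 < feresProb α 3 θ := by
  have hc : 0 < 2 * Real.cos α :=
    mul_pos zero_lt_two (Real.cos_pos_of_mem_Ioo ⟨by linarith, by linarith⟩)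
  refine feresProb_pos_of_flow_pos hα₀ hα₁ ⟨by linarith, by linarith⟩ ?_
  simp only [flow, Matrix.cons_val]
  split_ifs <;>
    first
    | linarith
    | exact div_pos (Real.sin_pos_of_pos_of_lt_pi (by linarith) (by linarith)) hc

/-! ### Reversibility of the Feres map -/

theorem angleMeasure_eq : angleMeasure = volume.withDensity
    ((Set.Ioo 0 Real.pi).indicator fun θ => ENNReal.ofReal (Real.sin θ / 2)) := by
  rw [withDensity_indicator measurableSet_Ioo, angleMeasure, restrict_Ioo_eq_restrict_Icc]

theorem ae_angleMeasure_iff {p : ℝ → Prop} :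
    (∀ᵐ θ ∂angleMeasure, p θ) ↔ ∀ᵐ θ : ℝ, θ ∈ Set.Ioo 0 Real.pi → p θ := by
  rw [angleMeasure_eq, ae_withDensity_iff (by measurability)]
  refine eventually_congr (ae_of_all _ fun θ => ?_)
  refine imp_congr_left ?_
  by_cases h : θ ∈ Set.Ioo 0 Real.pi
  · simp [h, Real.sin_pos_of_mem_Ioo h]
  · simp [h]

instance isProbabilityMeasure_angleMeasure : IsProbabilityMeasure angleMeasure := by
  refine ⟨?_⟩
  rw [angleMeasure, withDensity_apply _ MeasurableSet.univ, Measure.restrict_univ,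
    ← ofReal_integral_eq_lintegral_ofReal]
  · rw [integral_Icc_eq_integral_Ioc, ← intervalIntegral.integral_of_le Real.pi_pos.le,
      intervalIntegral.integral_div, integral_sin]
    norm_num
  · exact (Continuous.integrableOn_Icc (by fun_prop))
  · refine (ae_restrict_iff' measurableSet_Icc).2 (ae_of_all _ fun θ hθ => ?_)
    exact div_nonneg (Real.sin_nonneg_of_mem_Icc hθ) zero_le_two

/-- The flow through a branch as a density on the line, zero outside `(0, π)`. -/
noncomputable def flowDensity (α : ℝ) (i : Fin 4) : ℝ → ℝ≥0∞ :=
  (Set.Ioo 0 Real.pi).indicator fun θ => ENNReal.ofReal (flow α i θ / 2)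

/-- The index of the inverse of a branch: `T₁` and `T₃` (indices `0` and `2`) are inverse to each
other, `T₂` and `T₄` are involutions. -/
def inverseBranch : Equiv.Perm (Fin 4) := Equiv.swap 0 2

theorem feresMap_inverseBranch (i : Fin 4) (θ : ℝ) :
    feresMap α (inverseBranch i) (feresMap α i θ) = θ := by
  fin_cases i
  · simp [inverseBranch, feresMap]
  · simp [inverseBranch, feresMap, Equiv.swap_apply_of_ne_of_ne]
    ring
  · simp [inverseBranch, feresMap]
  · simp [inverseBranch, feresMap, Equiv.swap_apply_of_ne_of_ne]

theorem measurePreserving_feresMap (α : ℝ) (i : Fin 4) :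
    MeasurePreserving (feresMap α i) := by
  fin_cases i
  · exact measurePreserving_add_right volume (2 * α)
  · have h : feresMap α 1 = fun θ => 2 * Real.pi - 4 * α - θ := by
      ext θ; simp only [feresMap, Matrix.cons_val]; ring
    exact h ▸ Measure.measurePreserving_sub_left volume (2 * Real.pi - 4 * α)
  · exact measurePreserving_sub_right volume (2 * α)
  · have h : feresMap α 3 = fun θ => 4 * α - θ := by
      ext θ; simp only [feresMap, Matrix.cons_val]; ring
    exact h ▸ Measure.measurePreserving_sub_left volume (4 * α)

theorem flowDensity_of_mem {i : Fin 4} {θ : ℝ} (h0 : 0 < θ) (h1 : θ < Real.pi) :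
    flowDensity α i θ = ENNReal.ofReal (flow α i θ / 2) :=
  Set.indicator_of_mem (show θ ∈ Set.Ioo 0 Real.pi from ⟨h0, h1⟩) _

theorem flowDensity_eq_zero {i : Fin 4} {θ : ℝ}
    (h : 0 < θ → θ < Real.pi → flow α i θ = 0) : flowDensity α i θ = 0 := by
  by_cases h2 : θ ∈ Set.Ioo 0 Real.pi
  · rw [flowDensity_of_mem h2.1 h2.2, h h2.1 h2.2]; simp
  · exact Set.indicator_of_notMem h2 _

theorem flowDensity_zero_eq (hα₀ : 0 < α) (hα₁ : α < Real.pi / 6) {θ : ℝ} (h0 : θ ≠ 0) :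
    flowDensity α 0 θ = flowDensity α 2 (θ + 2 * α) := by
  rcases h0.lt_or_gt with h0 | h0
  · rw [flowDensity_eq_zero fun h => absurd h h0.not_gt, flowDensity_eq_zero fun _ _ => ?_]
    simp only [flow, Matrix.cons_val]
    rw [if_pos (by linarith)]
  rcases lt_or_ge θ (Real.pi - 2 * α) with h1 | h1
  · rw [flowDensity_of_mem h0 (by linarith), flowDensity_of_mem (by linarith) (by linarith)]
    simp only [flow, Matrix.cons_val]
    split_ifs <;> first | (exfalso; linarith) | ring_nf
  · rw [flowDensity_eq_zero fun _ _ => ?_, flowDensity_eq_zero fun _ h => ?_]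
    · linarith
    · simp only [flow, Matrix.cons_val]
      split_ifs <;> first | rfl | linarith

theorem flowDensity_one_eq (hα₀ : 0 < α) (hα₁ : α < Real.pi / 6) {θ : ℝ}
    (h1 : θ ≠ Real.pi - 3 * α) (h2 : θ ≠ Real.pi - 2 * α) (h3 : θ ≠ Real.pi - α) :
    flowDensity α 1 θ = flowDensity α 1 (-θ + 2 * Real.pi - 4 * α) := by
  have e : ∀ x y : ℝ, x + y = Real.pi → Real.sin x = Real.sin y := fun x y h => by
    rw [← Real.sin_pi_sub, ← h, add_sub_cancel_left]
  rcases h1.lt_or_gt with h1 | h1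
  · rw [flowDensity_eq_zero fun _ _ => ?_, flowDensity_eq_zero fun _ _ => ?_]
    all_goals
      simp only [flow, Matrix.cons_val]
      split_ifs <;> first | rfl | linarith
  rcases h3.lt_or_gt with h3 | h3
  · rw [flowDensity_of_mem (by linarith) (by linarith),
      flowDensity_of_mem (by linarith) (by linarith)]
    simp only [flow, Matrix.cons_val, neg_sin_eq_sin_sub_pi]
    rcases h2.lt_or_gt with h2 | h2
    · rw [if_neg (by linarith), if_pos (by linarith), if_neg (by linarith),
        if_neg (by linarith), if_pos (by linarith), e _ (-θ + 2 * Real.pi - 4 * α + α) (by ring)]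
    · rw [if_neg (by linarith), if_neg (by linarith), if_pos (by linarith), if_neg (by linarith),
        if_pos (by linarith), e _ (-θ + 2 * Real.pi - 4 * α + 3 * α - Real.pi) (by ring)]
  · rw [flowDensity_eq_zero fun _ _ => ?_, flowDensity_eq_zero fun _ _ => ?_]
    all_goals
      simp only [flow, Matrix.cons_val]
      split_ifs <;> first | rfl | linarith

theorem flowDensity_three_eq (hα₀ : 0 < α) (hα₁ : α < Real.pi / 6) {θ : ℝ}
    (h1 : θ ≠ α) (h2 : θ ≠ 2 * α) (h3 : θ ≠ 3 * α) :
    flowDensity α 3 θ = flowDensity α 3 (-θ + 4 * α) := by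
  rcases h1.lt_or_gt with h1 | h1
  · rw [flowDensity_eq_zero fun _ _ => ?_, flowDensity_eq_zero fun _ _ => ?_]
    all_goals
      simp only [flow, Matrix.cons_val]
      split_ifs <;> first | rfl | linarith
  rcases h3.lt_or_gt with h3 | h3
  · rw [flowDensity_of_mem (by linarith) (by linarith),
      flowDensity_of_mem (by linarith) (by linarith)]
    simp only [flow, Matrix.cons_val]
    split_ifs <;> first | (exfalso; exact h2 (by linarith)) | ring_nf
  · rw [flowDensity_eq_zero fun _ _ => ?_, flowDensity_eq_zero fun _ _ => ?_]
    all_goals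
      simp only [flow, Matrix.cons_val]
      split_ifs <;> first | rfl | linarith

/-- Detailed balance: the flow through a branch equals the flow back through its inverse. -/
theorem flowDensity_ae_eq (hα₀ : 0 < α) (hα₁ : α < Real.pi / 6) (i : Fin 4) :
    ∀ᵐ θ : ℝ, flowDensity α i θ = flowDensity α (inverseBranch i) (feresMap α i θ) := by
  have hne : ∀ c : ℝ, ∀ᵐ θ : ℝ, θ ≠ c := fun c => Measure.ae_ne _ c
  fin_cases i
  · filter_upwards [hne 0] with θ h
    exact flowDensity_zero_eq hα₀ hα₁ h
  · filter_upwards [hne (Real.pi - 3 * α), hne (Real.pi - 2 * α), hne (Real.pi - α)]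
      with θ h1 h2 h3
    exact flowDensity_one_eq hα₀ hα₁ h1 h2 h3
  · filter_upwards [hne (2 * α)] with θ h
    have := flowDensity_zero_eq hα₀ hα₁ (sub_ne_zero.2 h)
    rw [sub_add_cancel] at this
    exact this.symm
  · filter_upwards [hne α, hne (2 * α), hne (3 * α)] with θ h1 h2 h3
    exact flowDensity_three_eq hα₀ hα₁ h1 h2 h3

open Classical in
/-- The Feres kernel, made a Markov kernel on the whole line by letting the points outside
`(0, π)` rest. -/
noncomputable def feresMarkov (α : ℝ) : Kernel ℝ ℝ :=
  Kernel.piecewise (measurableSet_Ioo : MeasurableSet (Set.Ioo 0 Real.pi)) (feresKernel α)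
    Kernel.id

theorem feresMarkov_apply {θ : ℝ} (hθ : θ ∈ Set.Ioo 0 Real.pi) :
    feresMarkov α θ = feresKernel α θ := by
  rw [feresMarkov, Kernel.piecewise_apply, if_pos hθ]

theorem isMarkovKernel_feresMarkov (hα₀ : 0 < α) (hα₁ : α < Real.pi / 6) :
    IsMarkovKernel (feresMarkov α) := by
  refine ⟨fun θ => ?_⟩
  by_cases hθ : θ ∈ Set.Ioo 0 Real.pi
  · refine ⟨?_⟩
    rw [feresMarkov_apply hθ, feresKernel, randomKernel_apply_set _ _ MeasurableSet.univ]
    simp only [Set.indicator_univ, Pi.one_apply, mul_one]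
    rw [← ENNReal.ofReal_sum_of_nonneg fun i _ => feresProb_nonneg hα₀ hα₁ hθ i,
      sum_feresProb hα₀ hα₁, ENNReal.ofReal_one]
  · rw [feresMarkov, Kernel.piecewise_apply, if_neg hθ]
    infer_instance

theorem measurable_flowDensity (hα₀ : 0 < α) (hα₁ : α < Real.pi / 6) (i : Fin 4) :
    Measurable (flowDensity α i) := by
  have h : flowDensity α i = (Set.Ioo 0 Real.pi).indicator fun θ =>
      ENNReal.ofReal (feresProb α i θ * Real.sin θ / 2) :=
    Set.indicator_congr fun θ hθ => by rw [feresProb_mul_sin hα₀ hα₁ hθ]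
  have := measurable_feresProb α i
  rw [h]
  exact Measurable.indicator (by fun_prop) measurableSet_Ioo

theorem lintegral_feresMarkov (hα₀ : 0 < α) (hα₁ : α < Real.pi / 6) {A B : Set ℝ}
    (hA : MeasurableSet A) (hB : MeasurableSet B) :
    ∫⁻ θ in A, feresMarkov α θ B ∂angleMeasure =
      ∑ i, ∫⁻ θ, flowDensity α i θ * (A.indicator 1 θ * B.indicator 1 (feresMap α i θ)) := by
  have hBm : ∀ i, Measurable fun θ => B.indicator (1 : ℝ → ℝ≥0∞) (feresMap α i θ) := fun i =>
    (measurable_one.indicator hB).comp (measurable_feresMap α i)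
  have hm : ∀ i ∈ Finset.univ, Measurable fun θ =>
      flowDensity α i θ * (A.indicator (1 : ℝ → ℝ≥0∞) θ * B.indicator 1 (feresMap α i θ)) :=
    fun i _ => (measurable_flowDensity hα₀ hα₁ i).mul ((measurable_one.indicator hA).mul (hBm i))
  rw [← lintegral_finsetSum _ hm,
    ← lintegral_indicator hA, angleMeasure_eq, lintegral_withDensity_eq_lintegral_mul _
      (Measurable.indicator (by fun_prop) measurableSet_Ioo)
      ((Kernel.measurable_coe _ hB).indicator hA)]
  refine lintegral_congr fun θ => ?_
  by_cases hθ : θ ∈ Set.Ioo 0 Real.pi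
  · by_cases hθA : θ ∈ A
    · simp only [Pi.mul_apply, Set.indicator_of_mem hθ, Set.indicator_of_mem hθA,
        feresMarkov_apply hθ, feresKernel, randomKernel_apply_set _ _ hB, Finset.mul_sum,
        flowDensity, Pi.one_apply, one_mul]
      refine Finset.sum_congr rfl fun i _ => ?_
      have hs := (Real.sin_pos_of_mem_Ioo hθ).le
      rw [← mul_assoc, ← feresProb_mul_sin hα₀ hα₁ hθ, mul_div_assoc, mul_comm (feresProb α i θ),
        ENNReal.ofReal_mul (by positivity)]
    · simp [hθA]
  · simp [flowDensity, Set.indicator_of_notMem hθ]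

theorem isReversible_feresMarkov (hα₀ : 0 < α) (hα₁ : α < Real.pi / 6) :
    (feresMarkov α).IsReversible angleMeasure := by
  intro A B hA hB
  rw [lintegral_feresMarkov hα₀ hα₁ hA hB, lintegral_feresMarkov hα₀ hα₁ hB hA,
    ← Equiv.sum_comp inverseBranch fun i =>
      ∫⁻ θ, flowDensity α i θ * (B.indicator 1 θ * A.indicator 1 (feresMap α i θ))]
  refine Finset.sum_congr rfl fun i _ => ?_
  -- substitute `φ = T_i θ`
  have hm : Measurable fun φ => flowDensity α (inverseBranch i) φ *
      (B.indicator (1 : ℝ → ℝ≥0∞) φ * A.indicator 1 (feresMap α (inverseBranch i) φ)) :=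
    (measurable_flowDensity hα₀ hα₁ _).mul ((measurable_one.indicator hB).mul
      ((measurable_one.indicator hA).comp (measurable_feresMap α _)))
  rw [← (measurePreserving_feresMap α i).lintegral_comp hm]
  refine lintegral_congr_ae ?_
  filter_upwards [flowDensity_ae_eq hα₀ hα₁ i] with θ hθ
  rw [feresMap_inverseBranch, ← hθ, mul_comm (B.indicator _ _)]

theorem feresMarkov_ae_eq : ∀ᵐ θ ∂angleMeasure, feresKernel α θ = feresMarkov α θ :=
  ae_angleMeasure_iff.2 (ae_of_all _ fun _ hθ => (feresMarkov_apply hθ).symm)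

theorem evolve_feresMarkov (hα₀ : 0 < α) (hα₁ : α < Real.pi / 6) {ν : Measure ℝ}
    (hν : ν ≪ angleMeasure) (n : ℕ) :
    evolve (feresKernel α) ν n = evolve (feresMarkov α) ν n := by
  have := isMarkovKernel_feresMarkov hα₀ hα₁
  have hac : ∀ n, evolve (feresMarkov α) ν n ≪ angleMeasure := fun n => by
    induction n with
    | zero => exact hν
    | succ n ih =>
      have h := ih.comp_right (feresMarkov α)
      rwa [(isReversible_feresMarkov hα₀ hα₁).invariant.def] at h
  induction n with
  | zero => rfl
  | succ n ih =>
    rw [evolve, evolve, ih]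
    exact Measure.bind_congr_right ((hac n).ae_le feresMarkov_ae_eq)

/-! ### Ergodicity of the Feres map -/

/-- All possible transitions of the Feres map from `θ ∈ (0, π)` lead to points where `φ` has the
same value. -/
def ConstantAlong (α : ℝ) (φ : ℝ → ℝ) (θ : ℝ) : Prop :=
  θ ∈ Set.Ioo 0 Real.pi → ∃ c, ∀ i, 0 < feresProb α i θ → φ (feresMap α i θ) = c

theorem ae_constantAlong {φ : ℝ → ℝ} (hφ : Measurable φ)
    (h : ∀ᵐ θ ∂angleMeasure, ∃ c, ∀ᵐ y ∂feresMarkov α θ, φ y = c) :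
    ∀ᵐ θ : ℝ, ConstantAlong α φ θ := by
  filter_upwards [ae_angleMeasure_iff.1 h] with θ hc hθ
  obtain ⟨c, hc⟩ := hc hθ
  refine ⟨c, fun i hi => by_contra fun hne => ?_⟩
  have hm : MeasurableSet {y | ¬φ y = c} := (hφ (measurableSet_singleton c)).compl
  rw [ae_iff, feresMarkov_apply hθ, feresKernel, randomKernel_apply_set _ _ hm,
    Finset.sum_eq_zero_iff] at hc
  have h1 := hc i (Finset.mem_univ i)
  rw [Set.indicator_of_mem (show feresMap α i θ ∈ {y | ¬φ y = c} from hne)] at h1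
  simp at h1
  exact h1.not_gt hi

/-- `φ` is constant along the transitions from every point of the orbit of `x` under the group
generated by `x ↦ x + π`, `x ↦ x + α` and `x ↦ -x`, and this orbit does not meet the orbit
of `0`, which contains the endpoints of all intervals that occur. -/
def IsGeneric (α : ℝ) (φ : ℝ → ℝ) (x : ℝ) : Prop :=
  ∀ a b : ℤ, ConstantAlong α φ (x + (a * Real.pi + b * α)) ∧
    ConstantAlong α φ (-x + (a * Real.pi + b * α)) ∧ x + (a * Real.pi + b * α) ≠ 0

theorem ae_isGeneric {φ : ℝ → ℝ} (h : ∀ᵐ θ : ℝ, ConstantAlong α φ θ) :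
    ∀ᵐ x : ℝ, IsGeneric α φ x := by
  refine ae_all_iff.2 fun a => ae_all_iff.2 fun b => ?_
  set t := a * Real.pi + b * α
  have h1 := (measurePreserving_add_right (volume : Measure ℝ) t).quasiMeasurePreserving.ae h
  have h2 := ((measurePreserving_add_right (volume : Measure ℝ) t).comp
    (Measure.measurePreserving_neg volume)).quasiMeasurePreserving.ae h
  filter_upwards [h1, h2, Measure.ae_ne volume (-t)] with x h1 h2 h3
  exact ⟨h1, h2, fun h => h3 (eq_neg_of_add_eq_zero_left h)⟩

namespace IsGeneric

variable {φ : ℝ → ℝ} {x y : ℝ}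

theorem translate (hx : IsGeneric α φ x) (m n : ℤ) (hy : y = x + (m * Real.pi + n * α)) :
    IsGeneric α φ y := fun a b => by
  have h1 := hx (m + a) (n + b)
  have h2 := hx (a - m) (b - n)
  push_cast at h1 h2
  rw [show y + (a * Real.pi + b * α) = x + ((m + a) * Real.pi + (n + b) * α) by rw [hy]; ring,
    show -y + (a * Real.pi + b * α) = -x + ((a - m) * Real.pi + (b - n) * α) by rw [hy]; ring]
  exact ⟨h1.1, h2.2.1, h1.2.2⟩

theorem reflect (hx : IsGeneric α φ x) (m n : ℤ) (hy : y = -x + (m * Real.pi + n * α)) :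
    IsGeneric α φ y := by
  have h : IsGeneric α φ (-x) := fun a b => by
    have h1 := hx (-a) (-b)
    push_cast at h1
    refine ⟨(hx a b).2.1, by rw [neg_neg]; exact (hx a b).1, fun h0 => h1.2.2 ?_⟩
    linarith
  exact h.translate m n hy

theorem ne (hx : IsGeneric α φ x) (m n : ℤ) (hy : y = m * Real.pi + n * α) : x ≠ y := by
  have h := (hx (-m) (-n)).2.2
  push_cast at h
  rintro rfl
  exact h (by rw [hy]; ring)

theorem eq_of_pos (hx : IsGeneric α φ x) (h0 : 0 < x) (h1 : x < Real.pi) {i j : Fin 4}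
    (hi : 0 < feresProb α i x) (hj : 0 < feresProb α j x) :
    φ (feresMap α i x) = φ (feresMap α j x) := by
  have h := (hx 0 0).1
  simp only [Int.cast_zero, zero_mul, add_zero] at h
  obtain ⟨c, hc⟩ := h ⟨h0, h1⟩
  rw [hc i hi, hc j hj]

section Symmetries

variable (hα₀ : 0 < α) (hα₁ : α < Real.pi / 6)
include hα₀ hα₁

/-- The branches `T₁` and `T₃` are both possible at `x - 2α`. -/
theorem sub_period (hx : IsGeneric α φ x) (h0 : 4 * α < x) (h1 : x < Real.pi) :
    φ x = φ (x - 4 * α) := by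
  have hθ : IsGeneric α φ (x - 2 * α) := hx.translate 0 (-2) (by push_cast; ring)
  have h := hθ.eq_of_pos (by linarith) (by linarith)
    (feresProb_zero_pos hα₀ hα₁ (by linarith) (by linarith))
    (feresProb_two_pos hα₀ hα₁ (by linarith) (by linarith))
  simp only [feresMap, Matrix.cons_val] at h
  convert h using 2 <;> ring

/-- For `x < α`, the branches `T₃` and `T₄` are both possible at `x + 2α`. -/
theorem reflect_alpha (hx : IsGeneric α φ x) (h0 : 0 < x) (h1 : x < 2 * α) :
    φ (2 * α - x) = φ x := by
  wlog h : x < α generalizing x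
  · have hne : x ≠ α := hx.ne 0 1 (by push_cast; ring)
    have := this (x := 2 * α - x) (hx.reflect 0 2 (by push_cast; ring)) (by linarith)
      (by linarith) (by linarith [lt_of_le_of_ne (not_lt.1 h) hne.symm])
    rw [sub_sub_cancel] at this
    exact this.symm
  have hθ : IsGeneric α φ (x + 2 * α) := hx.translate 0 2 (by push_cast; ring)
  have h := hθ.eq_of_pos (by linarith) (by linarith)
    (feresProb_three_pos hα₀ hα₁ (by linarith) (by linarith))
    (feresProb_two_pos hα₀ hα₁ (by linarith) (by linarith))
  simp only [feresMap, Matrix.cons_val] at h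
  convert h using 2 <;> ring

/-- For `x > 3α`, the branches `T₁` and `T₄` are both possible at `x - 2α`. -/
theorem reflect_three_alpha (hx : IsGeneric α φ x) (h0 : 2 * α < x) (h1 : x < 4 * α) :
    φ (6 * α - x) = φ x := by
  wlog h : 3 * α < x generalizing x
  · have hne : x ≠ 3 * α := hx.ne 0 3 (by push_cast; ring)
    have := this (x := 6 * α - x) (hx.reflect 0 6 (by push_cast; ring)) (by linarith)
      (by linarith) (by linarith [lt_of_le_of_ne (not_lt.1 h) hne])
    rw [sub_sub_cancel] at this
    exact this.symm
  have hθ : IsGeneric α φ (x - 2 * α) := hx.translate 0 (-2) (by push_cast; ring)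
  have h := hθ.eq_of_pos (by linarith) (by linarith)
    (feresProb_three_pos hα₀ hα₁ (by linarith) (by linarith))
    (feresProb_zero_pos hα₀ hα₁ (by linarith) (by linarith))
  simp only [feresMap, Matrix.cons_val] at h
  convert h using 2 <;> ring

/-- For `x > π - α`, the branches `T₁` and `T₂` are both possible at `x - 2α`. -/
theorem reflect_pi_sub_alpha (hx : IsGeneric α φ x) (h0 : Real.pi - 2 * α < x)
    (h1 : x < Real.pi) : φ (2 * Real.pi - 2 * α - x) = φ x := by
  wlog h : Real.pi - α < x generalizing x
  · have hne : x ≠ Real.pi - α := hx.ne 1 (-1) (by push_cast; ring)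
    have := this (x := 2 * Real.pi - 2 * α - x) (hx.reflect 2 (-2) (by push_cast; ring))
      (by linarith) (by linarith) (by linarith [lt_of_le_of_ne (not_lt.1 h) hne])
    rw [sub_sub_cancel] at this
    exact this.symm
  have hθ : IsGeneric α φ (x - 2 * α) := hx.translate 0 (-2) (by push_cast; ring)
  have h := hθ.eq_of_pos (by linarith) (by linarith)
    (feresProb_one_pos hα₀ hα₁ (by linarith) (by linarith))
    (feresProb_zero_pos hα₀ hα₁ (by linarith) (by linarith))
  simp only [feresMap, Matrix.cons_val] at h
  convert h using 2 <;> ring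

/-- For `x < π - 3α`, the branches `T₂` and `T₃` are both possible at `x + 2α`. -/
theorem reflect_pi_sub_three_alpha (hx : IsGeneric α φ x) (h0 : Real.pi - 4 * α < x)
    (h1 : x < Real.pi - 2 * α) : φ (2 * Real.pi - 6 * α - x) = φ x := by
  wlog h : x < Real.pi - 3 * α generalizing x
  · have hne : x ≠ Real.pi - 3 * α := hx.ne 1 (-3) (by push_cast; ring)
    have := this (x := 2 * Real.pi - 6 * α - x) (hx.reflect 2 (-6) (by push_cast; ring))
      (by linarith) (by linarith) (by linarith [lt_of_le_of_ne (not_lt.1 h) hne.symm])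
    rw [sub_sub_cancel] at this
    exact this.symm
  have hθ : IsGeneric α φ (x + 2 * α) := hx.translate 0 2 (by push_cast; ring)
  have h := hθ.eq_of_pos (by linarith) (by linarith)
    (feresProb_one_pos hα₀ hα₁ (by linarith) (by linarith))
    (feresProb_two_pos hα₀ hα₁ (by linarith) (by linarith))
  simp only [feresMap, Matrix.cons_val] at h
  convert h using 2 <;> ring

variable {ψ : ℝ → ℝ} (hψ : Function.Periodic ψ (4 * α))
  (hψφ : ∀ x ∈ Set.Ico 0 (4 * α), ψ x = φ x)
include hψ hψφ

/-- On `(0, π)`, `φ` agrees with the periodic extension `ψ` of its restriction to `[0, 4α)`. -/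
theorem eq_periodic (hx : IsGeneric α φ x) (h0 : 0 < x) (h1 : x < Real.pi) : ψ x = φ x := by
  obtain ⟨n, hn⟩ := exists_nat_gt (x / (4 * α))
  rw [div_lt_iff₀ (by linarith)] at hn
  induction n generalizing x with
  | zero => simp at hn; linarith
  | succ n ih =>
    rcases lt_or_ge x (4 * α) with h | h
    · exact hψφ x ⟨h0.le, h⟩
    · have h4 : 4 * α < x := lt_of_le_of_ne h (hx.ne 0 4 (by push_cast; ring)).symm
      push_cast at hn
      rw [hx.sub_period hα₀ hα₁ h4 h1, ← hψ.sub_eq x]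
      exact ih (hx.translate 0 (-4) (by push_cast; ring)) (by linarith) (by linarith)
        (by linarith)

theorem periodic_reflect_alpha (hx : IsGeneric α φ x) : ψ (2 * α - x) = ψ x := by
  have h4 : 0 < 4 * α := by linarith
  -- reduction to `x ∈ [0, 4α)`
  wlog h : x ∈ Set.Ico 0 (4 * α) generalizing x
  · set k := toIcoDiv h4 0 x
    have hyk : toIcoMod h4 0 x = x - k * (4 * α) := by
      simp only [toIcoMod, zsmul_eq_mul, k]
    have hmem := toIcoMod_mem_Ico h4 0 x
    rw [hyk, zero_add] at hmem
    have h1 := this (x := x - k * (4 * α))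
      (hx.translate 0 (-4 * k) (by push_cast; ring)) hmem
    rw [hψ.sub_int_mul_eq, show 2 * α - (x - k * (4 * α)) = 2 * α - x + k * (4 * α) by ring,
      (hψ.int_mul k) (2 * α - x)] at h1
    exact h1
  have h0 : 0 < x := lt_of_le_of_ne h.1 (hx.ne 0 0 (by simp)).symm
  rw [hψφ x h]
  rcases (hx.ne 0 2 rfl).lt_or_gt with h2 | h2 <;> push_cast at h2
  · rw [hψφ _ ⟨by linarith, by linarith⟩]
    exact hx.reflect_alpha hα₀ hα₁ h0 (by linarith)
  · rw [← hψ, hψφ _ ⟨by linarith [h.2], by linarith⟩,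
      ← hx.reflect_three_alpha hα₀ hα₁ (by linarith) h.2]
    congr 1; ring

theorem periodic_reflect_pi_sub_alpha (hx : IsGeneric α φ x) :
    ψ (2 * Real.pi - 2 * α - x) = ψ x := by
  have h4 : 0 < 4 * α := by linarith
  -- reduction to `x ∈ [π - 4α, π)`
  wlog h : x ∈ Set.Ico (Real.pi - 4 * α) Real.pi generalizing x
  · set k := toIcoDiv h4 (Real.pi - 4 * α) x
    have hyk : toIcoMod h4 (Real.pi - 4 * α) x = x - k * (4 * α) := by
      simp only [toIcoMod, zsmul_eq_mul, k]
    have hmem := toIcoMod_mem_Ico h4 (Real.pi - 4 * α) x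
    rw [hyk, sub_add_cancel] at hmem
    have h1 := this (x := x - k * (4 * α))
      (hx.translate 0 (-4 * k) (by push_cast; ring)) hmem
    rw [hψ.sub_int_mul_eq, show 2 * Real.pi - 2 * α - (x - k * (4 * α)) =
      2 * Real.pi - 2 * α - x + k * (4 * α) by ring,
      (hψ.int_mul k) (2 * Real.pi - 2 * α - x)] at h1
    exact h1
  have h0 : Real.pi - 4 * α < x :=
    lt_of_le_of_ne h.1 (hx.ne 1 (-4) (by push_cast; ring)).symm
  rw [hx.eq_periodic hα₀ hα₁ hψ hψφ (by linarith) h.2]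
  rcases (hx.ne 1 (-2) rfl).lt_or_gt with h2 | h2 <;> push_cast at h2
  · rw [← hψ.sub_eq, ← hx.reflect_pi_sub_three_alpha hα₀ hα₁ h0 (by linarith),
      show 2 * Real.pi - 2 * α - x - 4 * α = 2 * Real.pi - 6 * α - x by ring]
    exact (hx.reflect 2 (-6) (by push_cast; ring)).eq_periodic hα₀ hα₁ hψ hψφ (by linarith)
      (by linarith)
  · rw [← hx.reflect_pi_sub_alpha hα₀ hα₁ (by linarith) h.2]
    exact (hx.reflect 2 (-2) (by push_cast; ring)).eq_periodic hα₀ hα₁ hψ hψφ (by linarith [h.2])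
      (by linarith)

/-- The reflections about `α` and `π - α` compose to a translation, which is `2π` modulo the
period `4α`. -/
theorem periodic_add_two_pi (hx : IsGeneric α φ x) : ψ (2 * Real.pi + x) = ψ x := by
  have h1 := (hx.reflect (y := -2 * α - x) 0 (-2) (by push_cast; ring)
    ).periodic_reflect_pi_sub_alpha hα₀ hα₁ hψ hψφ
  have h2 := hx.periodic_reflect_alpha hα₀ hα₁ hψ hψφ
  rw [show 2 * Real.pi - 2 * α - (-2 * α - x) = 2 * Real.pi + x by ring, ← hψ (-2 * α - x),
    show -2 * α - x + 4 * α = 2 * α - x by ring, h2] at h1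
  exact h1

end Symmetries

end IsGeneric

theorem addOrderOf_two_pi_eq_zero (hα : Irrational (α / Real.pi)) :
    addOrderOf ((2 * Real.pi : ℝ) : AddCircle (4 * α)) = 0 := by
  rw [addOrderOf_eq_zero_iff']
  intro n hn h0
  rw [← AddCircle.coe_nsmul, AddCircle.coe_eq_zero_iff] at h0
  obtain ⟨m, hm⟩ := h0
  rw [zsmul_eq_mul, nsmul_eq_mul] at hm
  have hπ := Real.pi_pos
  have hn' : (0 : ℝ) < n := by exact_mod_cast hn
  have hm0 : (m : ℝ) ≠ 0 := by
    intro h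
    rw [h, zero_mul] at hm
    exact absurd hm (by positivity)
  refine hα ⟨n / (2 * m), ?_⟩
  push_cast
  field_simp
  linarith

theorem ae_coe_addCircle {p : ℝ} [Fact (0 < p)] {q : AddCircle p → Prop}
    (h : ∀ᵐ z, q z) : ∀ᵐ x : ℝ, q (x : AddCircle p) := by
  have hp : 0 < p := Fact.out
  rw [← Measure.restrict_univ (μ := (volume : Measure ℝ)), ← iUnion_Ioc_add_zsmul hp 0,
    ae_restrict_iUnion_iff]
  intro n
  have := (AddCircle.measurePreserving_mk p (0 + n • p)).quasiMeasurePreserving.ae h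
  rwa [add_assoc, ← add_one_zsmul] at this

/-- Ergodicity of the Feres map: the periodic extension of a function that is constant along
almost every transition is invariant under an irrational rotation. -/
theorem ae_eq_const_of_constantAlong (hα₀ : 0 < α) (hα₁ : α < Real.pi / 6)
    (hα : Irrational (α / Real.pi)) {φ : ℝ → ℝ} (hφ : Measurable φ)
    (h : ∀ᵐ θ : ℝ, ConstantAlong α φ θ) : ∃ c, ∀ᵐ θ ∂angleMeasure, φ θ = c := by
  have : Fact (0 < 4 * α) := ⟨by linarith⟩
  let Ψ : AddCircle (4 * α) → ℝ := fun z => φ (AddCircle.measurableEquivIco (4 * α) 0 z : ℝ)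
  have hΨ : Measurable Ψ := hφ.comp
    (measurable_subtype_coe.comp (AddCircle.measurableEquivIco (4 * α) 0).measurable)
  have hψ : Function.Periodic (fun x : ℝ => Ψ x) (4 * α) := fun x => by
    simp only [AddCircle.coe_add_period]
  have hψφ : ∀ x ∈ Set.Ico 0 (4 * α), Ψ (x : ℝ) = φ x := fun x hx => by
    have := AddCircle.equivIco_coe_eq (p := 4 * α) (a := 0) (x := x) (by simpa using hx)
    exact congrArg (fun y => φ (Subtype.val y)) this
  have hgen := ae_isGeneric h
  have hinv : Ψ ∘ (((2 * Real.pi : ℝ) : AddCircle (4 * α)) + ·) =ᵐ[volume] Ψ := by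
    have hmp := AddCircle.measurePreserving_mk (4 * α) 0
    have hm : MeasurableSet {z | Ψ (((2 * Real.pi : ℝ) : AddCircle (4 * α)) + z) = Ψ z} :=
      measurableSet_eq_fun (hΨ.comp (measurable_const_add _)) hΨ
    change ∀ᵐ z, Ψ (((2 * Real.pi : ℝ) : AddCircle (4 * α)) + z) = Ψ z
    rw [← hmp.map_eq, ae_map_iff hmp.measurable.aemeasurable hm]
    refine ae_restrict_of_ae (hgen.mono fun x hx => ?_)
    rw [← AddCircle.coe_add]
    exact hx.periodic_add_two_pi hα₀ hα₁ hψ hψφ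
  obtain ⟨c, hc⟩ := (AddCircle.ergodic_add_left.2
    (addOrderOf_two_pi_eq_zero hα)).ae_eq_const_of_ae_eq_comp₀ hΨ.nullMeasurable hinv
  refine ⟨c, ae_angleMeasure_iff.2 ?_⟩
  filter_upwards [hgen, ae_coe_addCircle hc] with x hx hxc hmem
  exact (hx.eq_periodic hα₀ hα₁ hψ hψφ hmem.1 hmem.2).symm.trans hxc

theorem tendsto_evolve_feresKernel (hα₀ : 0 < α) (hα₁ : α < Real.pi / 6)
    (hα : Irrational (α / Real.pi)) {ν : Measure ℝ} [IsProbabilityMeasure ν]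
    (hν : ν ≪ angleMeasure) {B : Set ℝ} (hB : MeasurableSet B) :
    Tendsto (fun n => evolve (feresKernel α) ν n B) atTop (𝓝 (angleMeasure B)) := by
  have := isMarkovKernel_feresMarkov hα₀ hα₁
  simp only [evolve_feresMarkov hα₀ hα₁ hν]
  exact tendsto_evolve_of_isReversible (isReversible_feresMarkov hα₀ hα₁)
    (fun φ hφ h => ae_eq_const_of_constantAlong hα₀ hα₁ hα hφ (ae_constantAlong hφ h)) hν hB

end CircularBilliard

theorem mainTheorem3 (P : CircularBilliard.Plane) (r : ℝ) (hr : P.IsRadius r)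
    (α : ℝ) (hα₀ : 0 < α) (hα₁ : α < Real.pi / 6) (hα : Irrational (α / Real.pi))
    (g : ℝ → ℝ≥0∞) (hg : AEMeasurable g CircularBilliard.angleMeasure)
    (hg₁ : ∫⁻ θ, g θ ∂CircularBilliard.angleMeasure = 1)
    (ν₂ : Measure ℝ) (hν₂ : ν₂ = CircularBilliard.angleMeasure.withDensity g)
    (ν : Measure (ℝ × ℝ)) (hν : ν = (P.positionMeasure r).prod ν₂) :
    (∀ n : ℕ, CircularBilliard.evolve (P.billiardKernel r α) ν n =
      (P.positionMeasure r).prod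
        (CircularBilliard.evolve (CircularBilliard.feresKernel α) ν₂ n)) ∧
    ∀ A B : Set ℝ, MeasurableSet A → MeasurableSet B →
      Tendsto (fun n : ℕ => CircularBilliard.evolve (P.billiardKernel r α) ν n (A ×ˢ B)) atTop
        (𝓝 (((P.positionMeasure r).prod CircularBilliard.angleMeasure) (A ×ˢ B))) := by
  have hprob : IsProbabilityMeasure ν₂ := ⟨by
    rw [hν₂, withDensity_apply _ MeasurableSet.univ, Measure.restrict_univ, hg₁]⟩
  have hac : ν₂ ≪ CircularBilliard.angleMeasure := hν₂ ▸ withDensity_absolutelyContinuous _ _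
  have hprod := P.evolve_billiardKernel hr α ν₂
  rw [← hν] at hprod
  refine ⟨hprod, fun A B _ hB => ?_⟩
  have hmarkov := CircularBilliard.isMarkovKernel_feresMarkov hα₀ hα₁
  have hs : ∀ n, SFinite (CircularBilliard.evolve (CircularBilliard.feresKernel α) ν₂ n) :=
    fun n => by
      rw [CircularBilliard.evolve_feresMarkov hα₀ hα₁ hac]
      infer_instance
  simp only [hprod, Measure.prod_prod]
  exact ENNReal.Tendsto.const_mul
    (CircularBilliard.tendsto_evolve_feresKernel hα₀ hα₁ hα hac hB)
    (Or.inr (measure_ne_top _ _))
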